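/- **Theorem 8.** Let $M$ be an oriented one-dimensional smooth manifold with a smooth affine connection $\nabla$ (automatically flat and torsion free), let $F^+$ be its bundle of positive frames, and let $\Gamma$ be a pseudogroup of orientation preserving local diffeomorphisms of $M$; each $\varphi\in\Gamma$ acts on $F^+$ by a local diffeomorphism $\widetilde\varphi$. Let $G=F^+\rtimes\Gamma$ be the étale groupoid of pairs $(\varphi,\alpha)$, where $\alpha\in F^+$ lies over a point of ${\rm Dom}\,\varphi$ and only the germ of $\varphi$ at this point matters, with source $\alpha$ and range $\widetilde\varphi\,\alpha$. Let $C_c^\infty(G)$ be the crossed product, the linear span of the monomials $f\,U_\psi^*$ with $\psi\in\Gamma$ and $f\in C_c^\infty(F^+|_{{\rm Dom}\,\psi})$: $f\,U^*_\psi$ takes at $g=(\psi^{-1},\widetilde\psi\,\beta)$ the value $f(\beta)$, and $0$ at all other elements. (If $G$ is not Hausdorff, elements of $C_c^\infty(G)$ are understood as giving, at each $g$, the germ of a smooth function at the range of $g$, and $f(g)$ denotes the value of this germ.) Let $X$ be the horizontal vector field of $\nabla$ on $F^+$, $\omega$ the connection form, $\alpha_{\rm can}$ the canonical form, and let $\gamma^\psi$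 be the function with $\widetilde\psi^{*}\omega-\omega=\gamma^\psi\,\alpha_{\rm can}$. Operators on $C_c^\infty(G)$ are defined by $X(fU_\psi^*)=(Xf)\,U_\psi^*$, $\delta_1(fU_\psi^*)=\gamma^\psi f\,U_\psi^*$ and $\delta_{n+1}=[X,\delta_n]$. For $\alpha=(x,y)\in F^+$ let $\exp_\alpha(t)=\exp^\nabla_x(ty)$. Then $$\gamma(\varphi,\alpha)=\exp_{\widetilde\varphi\,\alpha}^{-1}\circ\varphi\circ\exp_\alpha$$ is a well defined homomorphism from $G$ to the group of germs at $0$ of smooth local diffeomorphisms $\psi$ of $\mathbb R$ with $\psi(0)=0$, $\psi'(0)=1$. On such germs let $\delta_n(\psi)=(\log\psi')^{(n)}(0)$. Then for all $n\ge1$, $f\in C_c^\infty(G)$ and $g\in G$ $$(\delta_n f)(g)=\delta_n\big(\gamma(g)^{-1}\big)\,f(g).$$ Moreover these coordinates come from the Hopf algebra ${\cal H}^1=\mathbb R[\delta_1,\delta_2,\dots]$ with coproduct determined by $\Delta\delta_1=\delta_1\otimes1+1\otimes\delta_1$ and $\Delta\delta_{n+1}=[X\otimes1+1\otimes X+\delta_1\otimes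 Y,\ \Delta\delta_n]$, where $[X,\delta_n]=\delta_{n+1}$, $[Y,\delta_n]=n\,\delta_n$. Its dual algebra $({\cal H}^1)^*$, which is the completed enveloping algebra of the Lie algebra ${\cal A}^1$ of formal vector fields vanishing to order $2$ at $0$, acts continuously on $\mathbb R[[x]]$, with $Z_k:P\mapsto(\partial P/\partial\delta_k)(0)$ acting as $\frac{x^{k+1}}{(k+1)!}\,\partial_x$. For each germ $\varphi$ as above there is exactly one group-like element $A\in G({\cal A}^1)\subset({\cal H}^1)^*$ with $A f=f\circ\varphi^{-1}$ for all $f$, and it satisfies $\langle\delta_n,A\rangle=(\log\psi')^{(n)}(0)$, $\psi=\varphi^{-1}$, for all $n\ge1$. In particular $\delta_n(\gamma(g)^{-1})$ is the pairing of $\delta_n$ with the group-like element identified with $\gamma(g)$. -/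

import Mathlib

open Filter Topology
open scoped Manifold ContDiff TensorProduct

noncomputable section

namespace CrossedProduct

/-! ## Germs of diffeomorphisms of the line tangent to the identity at `0` -/

/-- A smooth local diffeomorphism of `ℝ`, defined near `0`, with `φ 0 = 0` and `φ' 0 = 1`. -/
structure DiffeoRep where
  toHomeo : OpenPartialHomeomorph ℝ ℝ
  zero_mem : (0 : ℝ) ∈ toHomeo.source
  map_zero : toHomeo 0 = 0
  smooth : ContDiffOn ℝ ∞ toHomeo toHomeo.source
  smooth_symm : ContDiffOn ℝ ∞ toHomeo.symm toHomeo.target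
  deriv_zero : deriv toHomeo 0 = 1

namespace DiffeoRep

theorem zero_mem_target (a : DiffeoRep) : (0 : ℝ) ∈ a.toHomeo.target := by
  have h := a.toHomeo.map_source a.zero_mem
  rwa [a.map_zero] at h

theorem symm_zero (a : DiffeoRep) : a.toHomeo.symm 0 = 0 := by
  have h := a.toHomeo.left_inv a.zero_mem
  rwa [a.map_zero] at h

theorem hasDerivAt_zero (a : DiffeoRep) : HasDerivAt a.toHomeo 1 0 := by
  have h : DifferentiableAt ℝ a.toHomeo 0 :=
    (a.smooth.contDiffAt (a.toHomeo.open_source.mem_nhds a.zero_mem)).differentiableAt (by simp)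
  have h' := h.hasDerivAt
  rwa [a.deriv_zero] at h'

theorem hasDerivAt_symm_zero (a : DiffeoRep) : HasDerivAt a.toHomeo.symm 1 0 := by
  have h := a.toHomeo.hasDerivAt_symm a.zero_mem_target (f' := 1) one_ne_zero
    (by rw [a.symm_zero]; exact a.hasDerivAt_zero)
  simpa using h

/-- The identity. -/
def one : DiffeoRep where
  toHomeo := OpenPartialHomeomorph.refl ℝ
  zero_mem := by simp
  map_zero := by simp
  smooth := by simpa using contDiff_id.contDiffOn
  smooth_symm := by simpa using contDiff_id.contDiffOn
  deriv_zero := by simp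

/-- The inverse local diffeomorphism. -/
def inv (a : DiffeoRep) : DiffeoRep where
  toHomeo := a.toHomeo.symm
  zero_mem := a.zero_mem_target
  map_zero := a.symm_zero
  smooth := a.smooth_symm
  smooth_symm := by simpa using a.smooth
  deriv_zero := a.hasDerivAt_symm_zero.deriv

/-- The composition `t ↦ a (b t)`. -/
def mul (a b : DiffeoRep) : DiffeoRep where
  toHomeo := b.toHomeo.trans a.toHomeo
  zero_mem := by
    simp only [OpenPartialHomeomorph.trans_source, Set.mem_inter_iff, Set.mem_preimage]
    exact ⟨b.zero_mem, by rw [b.map_zero]; exact a.zero_mem⟩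
  map_zero := by simp [a.map_zero, b.map_zero]
  smooth := by
    rw [OpenPartialHomeomorph.trans_source]
    exact a.smooth.comp (b.smooth.mono Set.inter_subset_left) (fun x hx => hx.2)
  smooth_symm := by
    rw [OpenPartialHomeomorph.trans_target]
    exact b.smooth_symm.comp (a.smooth_symm.mono Set.inter_subset_left) (fun x hx => hx.2)
  deriv_zero := by
    have h : HasDerivAt (a.toHomeo ∘ b.toHomeo) (1 * 1) 0 :=
      HasDerivAt.comp (0 : ℝ) (by rw [b.map_zero]; exact a.hasDerivAt_zero) b.hasDerivAt_zero
    have h' := h.deriv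
    simpa using h'

theorem tendsto (a : DiffeoRep) : Tendsto a.toHomeo (𝓝 0) (𝓝 0) := by
  have h := a.hasDerivAt_zero.continuousAt.tendsto
  rwa [a.map_zero] at h

/-- Two local diffeomorphisms are identified when they agree near `0`. -/
instance setoid : Setoid DiffeoRep where
  r a b := (a.toHomeo : ℝ → ℝ) =ᶠ[𝓝 0] b.toHomeo
  iseqv := ⟨fun _ => EventuallyEq.rfl, fun h => h.symm, fun h h' => h.trans h'⟩

theorem inv_congr {a b : DiffeoRep} (h : a ≈ b) : a.inv ≈ b.inv := by
  have h1 : (a.toHomeo : ℝ → ℝ) =ᶠ[𝓝 0] b.toHomeo := h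
  have h2 := a.inv.tendsto.eventually h1
  have h3 := a.inv.tendsto.eventually (b.toHomeo.open_source.mem_nhds b.zero_mem)
  have h4 := a.toHomeo.open_target.mem_nhds a.zero_mem_target
  change (a.toHomeo.symm : ℝ → ℝ) =ᶠ[𝓝 0] b.toHomeo.symm
  filter_upwards [h2, h3, h4] with t ht hs hm
  change a.toHomeo (a.toHomeo.symm t) = b.toHomeo (a.toHomeo.symm t) at ht
  change a.toHomeo.symm t ∈ b.toHomeo.source at hs
  rw [a.toHomeo.right_inv hm] at ht
  conv_rhs => rw [ht]
  rw [b.toHomeo.left_inv hs]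

theorem mul_congr {a a' b b' : DiffeoRep} (ha : a ≈ a') (hb : b ≈ b') : a.mul b ≈ a'.mul b' := by
  have h1 : (a.toHomeo : ℝ → ℝ) =ᶠ[𝓝 0] a'.toHomeo := ha
  have h2 : (b.toHomeo : ℝ → ℝ) =ᶠ[𝓝 0] b'.toHomeo := hb
  have h3 := b.tendsto.eventually h1
  change (a.toHomeo ∘ b.toHomeo : ℝ → ℝ) =ᶠ[𝓝 0] a'.toHomeo ∘ b'.toHomeo
  filter_upwards [h2, h3] with t ht hs
  simp only [Function.comp_apply, ← ht, hs]

end DiffeoRep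

/-- Germs at `0` of smooth local diffeomorphisms `φ` of `ℝ` with `φ 0 = 0`, `φ' 0 = 1`. -/
def DiffeoGerm : Type := Quotient DiffeoRep.setoid

namespace DiffeoGerm

/-- The germ of a local diffeomorphism. -/
def mk (a : DiffeoRep) : DiffeoGerm := Quotient.mk _ a

/-- The group structure is composition of germs. -/
instance : Group DiffeoGerm where
  one := mk DiffeoRep.one
  mul := Quotient.map₂ DiffeoRep.mul fun _ _ h _ _ h' => DiffeoRep.mul_congr h h'
  inv := Quotient.map DiffeoRep.inv fun _ _ h => DiffeoRep.inv_congr h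
  mul_assoc := by
    rintro ⟨a⟩ ⟨b⟩ ⟨c⟩
    exact Quotient.sound (EventuallyEq.rfl)
  one_mul := by
    rintro ⟨a⟩
    exact Quotient.sound (EventuallyEq.rfl)
  mul_one := by
    rintro ⟨a⟩
    exact Quotient.sound (EventuallyEq.rfl)
  inv_mul_cancel := by
    rintro ⟨a⟩
    refine Quotient.sound ?_
    change (a.toHomeo.symm ∘ a.toHomeo : ℝ → ℝ) =ᶠ[𝓝 0] id
    filter_upwards [a.toHomeo.open_source.mem_nhds a.zero_mem] with t ht
    exact a.toHomeo.left_inv ht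

/-- The coordinates `δₙ(ψ) = (log ψ')⁽ⁿ⁾(0)` of a germ. -/
def coord (n : ℕ) : DiffeoGerm → ℝ :=
  Quotient.lift (fun a : DiffeoRep => iteratedDeriv n (fun t => Real.log (deriv a.toHomeo t)) 0)
    (fun a b h => by
      have h1 : (a.toHomeo : ℝ → ℝ) =ᶠ[𝓝 0] b.toHomeo := h
      refine Filter.EventuallyEq.iteratedDeriv_eq n ?_
      filter_upwards [h1.deriv] with t ht
      rw [ht])

/-- The Taylor series at `0` of a germ. -/
def taylor : DiffeoGerm → PowerSeries ℝ :=
  Quotient.lift (fun a : DiffeoRep =>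
      PowerSeries.mk fun n => iteratedDeriv n a.toHomeo 0 / (n.factorial : ℝ))
    (fun a b h => by
      have h1 : (a.toHomeo : ℝ → ℝ) =ᶠ[𝓝 0] b.toHomeo := h
      ext n
      simp only [PowerSeries.coeff_mk]
      rw [Filter.EventuallyEq.iteratedDeriv_eq n h1])

end DiffeoGerm

/-! ## The commutative Hopf algebra of the `δₙ` and its dual algebra -/

/-- The algebra of polynomials in `δ₁, δ₂, …`; the variable with index `n` is `δₙ₊₁`. -/
abbrev HopfAlg : Type := MvPolynomial ℕ ℝ

/-- The generator `δₙ₊₁`. -/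
def hopfDelta (n : ℕ) : HopfAlg := MvPolynomial.X n

/-- The derivation `P ↦ [X, P]`, that is `δₙ ↦ δₙ₊₁`. -/
def adX : Derivation ℝ HopfAlg HopfAlg :=
  MvPolynomial.mkDerivation ℝ fun n => hopfDelta (n + 1)

/-- The derivation `P ↦ [Y, P]`, that is `δₙ ↦ n δₙ`. -/
def adY : Derivation ℝ HopfAlg HopfAlg :=
  MvPolynomial.mkDerivation ℝ fun n => ((n : ℝ) + 1) • hopfDelta n

/-- The commutator with `Δ X = X ⊗ 1 + 1 ⊗ X + δ₁ ⊗ Y` on polynomials in the `δₙ`. -/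
def adCoprodX : HopfAlg ⊗[ℝ] HopfAlg →ₗ[ℝ] HopfAlg ⊗[ℝ] HopfAlg :=
  TensorProduct.map (adX : HopfAlg →ₗ[ℝ] HopfAlg) LinearMap.id
    + TensorProduct.map LinearMap.id (adX : HopfAlg →ₗ[ℝ] HopfAlg)
    + TensorProduct.map (LinearMap.mulLeft ℝ (hopfDelta 0)) (adY : HopfAlg →ₗ[ℝ] HopfAlg)

/-- The coproduct of `δₙ₊₁`: `Δ δ₁ = δ₁ ⊗ 1 + 1 ⊗ δ₁` and `Δ δₙ₊₁ = [Δ X, Δ δₙ]`. -/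
def coprodDelta : ℕ → HopfAlg ⊗[ℝ] HopfAlg
  | 0 => hopfDelta 0 ⊗ₜ[ℝ] 1 + 1 ⊗ₜ[ℝ] hopfDelta 0
  | n + 1 => adCoprodX (coprodDelta n)

/-- The coproduct, an algebra homomorphism. -/
def coprod : HopfAlg →ₐ[ℝ] HopfAlg ⊗[ℝ] HopfAlg := MvPolynomial.aeval coprodDelta

/-- The space of all linear forms on the Hopf algebra; with the product `conv` it is the completed
enveloping algebra of the Lie algebra of formal vector fields `f(x) ∂/∂x`, `f(0) = f'(0) = 0`. -/
abbrev DualAlg : Type := HopfAlg →ₗ[ℝ] ℝ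

/-- The product of linear forms dual to the coproduct: `⟨L L', P⟩ = ⟨L ⊗ L', Δ P⟩`. -/
def conv (L L' : DualAlg) : DualAlg :=
  (TensorProduct.lid ℝ ℝ).toLinearMap ∘ₗ TensorProduct.map L L' ∘ₗ coprod.toLinearMap

/-- The unit of the dual algebra, `P ↦ P(0)`. -/
def counit : DualAlg := (MvPolynomial.aeval fun _ : ℕ => (0 : ℝ)).toLinearMap

/-- The linear form `P ↦ (∂P/∂δₖ₊₁)(0)`, the element `Zₖ₊₁` of the Lie algebra. -/
def dualZ (k : ℕ) : DualAlg :=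
  counit ∘ₗ (MvPolynomial.pderiv k : Derivation ℝ HopfAlg HopfAlg).toLinearMap

/-- Group-like elements `ψ` (`Δψ = ψ ⊗ ψ`, `ψ ≠ 0`), where `Δ` is dual to the product. -/
def IsGroupLike (L : DualAlg) : Prop := L 1 = 1 ∧ ∀ P Q : HopfAlg, L (P * Q) = L P * L Q

/-- `R` is the action of the completed enveloping algebra on (formal) functions on the line: the
unital algebra homomorphism, continuous in the sense that each coefficient of `R(L) f` is the
evaluation of `L` on some element of the Hopf algebra, for which `Zₖ` acts as the vector field
`x^(k+1)/(k+1)! ∂/∂x`. (Linear forms generated by the `Zₖ` separate the elements of the Hopf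
algebra, so there is only one such `R`.) -/
structure IsFunctionAction
    (R : DualAlg →ₗ[ℝ] (PowerSeries ℝ →ₗ[ℝ] PowerSeries ℝ)) : Prop where
  map_one : R counit = LinearMap.id
  map_mul : ∀ L L' : DualAlg, R (conv L L') = R L ∘ₗ R L'
  map_Z : ∀ (k : ℕ) (f : PowerSeries ℝ), R (dualZ k) f =
    (((k + 2).factorial : ℝ)⁻¹) • (PowerSeries.X ^ (k + 2) * PowerSeries.derivative ℝ f)
  continuous : ∀ (f : PowerSeries ℝ) (m : ℕ), ∃ P : HopfAlg, ∀ L : DualAlg,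
    PowerSeries.coeff m (R L f) = L P

/-- The identification of group-like elements with germs of diffeomorphisms: `A` corresponds to
`φ` when `A f = f ∘ φ⁻¹` for every function `f`. -/
def Corresponds (R : DualAlg →ₗ[ℝ] (PowerSeries ℝ →ₗ[ℝ] PowerSeries ℝ)) (A : DualAlg)
    (φ : DiffeoGerm) : Prop :=
  IsGroupLike A ∧ ∀ f : PowerSeries ℝ, R A f = PowerSeries.subst (φ⁻¹).taylor f

/-! ## Oriented one-dimensional manifolds with a connection, and their frame bundle -/

section Manifold

variable (M : Type*) [TopologicalSpace M] [ChartedSpace ℝ M]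

/-- `M` is oriented: the changes of charts of its atlas are increasing. -/
def IsOrientedAtlas : Prop :=
  ∀ e ∈ atlas ℝ M, ∀ e' ∈ atlas ℝ M, ∀ u ∈ (e.symm.trans e').source,
    0 < deriv (e.symm.trans e') u

variable [IsManifold 𝓘(ℝ, ℝ) ∞ M]

/-- An affine connection on `M` (in dimension one it is automatically flat and torsion free). -/
abbrev Connection : Type _ :=
  CovariantDerivative 𝓘(ℝ, ℝ) ℝ (TangentSpace 𝓘(ℝ, ℝ) : M → Type _)

variable {M} in
/-- The coordinate `y` of a frame `(x, y)` in the preferred chart at `x`. -/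
def frameCoord (p : TangentBundle 𝓘(ℝ, ℝ) M) : ℝ := p.2

/-- The set of positive frames in the tangent bundle: an orientation preserving frame at `x` is
the same thing as a positive tangent vector at `x`, the image of `1` under it. -/
def posFrames : Set (TangentBundle 𝓘(ℝ, ℝ) M) := {p | 0 < frameCoord p}

/-- The bundle `F⁺` of positive frames. -/
abbrev PosFrame : Type _ := posFrames M

variable {M}

/-- The coordinate vector field `∂/∂x` of the preferred chart at `x₀`. -/
def coordField (x₀ : M) (x : M) : TangentSpace 𝓘(ℝ, ℝ) x :=
  tangentCoordChange 𝓘(ℝ, ℝ) x₀ x x (1 : ℝ)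

/-- The Christoffel symbol at `x`, `∇_∂ ∂ = Γ ∂`, in the preferred chart at `x`. -/
def christoffel (D : Connection M) (x : M) : ℝ := D (coordField x) x (1 : ℝ)

/-- The horizontal vector field `X = y (∂ₓ - Γ y ∂_y)` of the connection; at each point it is
written in the preferred chart of that point. -/
def horizontal (D : Connection M) (p : TangentBundle 𝓘(ℝ, ℝ) M) :
    TangentSpace 𝓘(ℝ, ℝ).tangent p :=
  ((frameCoord p, -(christoffel D p.1 * frameCoord p ^ 2)) : ℝ × ℝ)

/-- The connection form `ω = y⁻¹ (dy + Γ y dx)` on the frame bundle. -/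
def connForm (D : Connection M) (p : TangentBundle 𝓘(ℝ, ℝ) M)
    (v : TangentSpace 𝓘(ℝ, ℝ).tangent p) : ℝ :=
  let w : ℝ × ℝ := v
  (w.2 + christoffel D p.1 * frameCoord p * w.1) / frameCoord p

/-- The function `γ^ψ` on the frame bundle with `ψ̃* ω - ω = γ^ψ α`, where `α = y⁻¹ dx` is the
canonical form; as `α(X) = 1` it is the value of the left-hand side on `X`. -/
def cocycle (D : Connection M) (ψ : M → M) (p : TangentBundle 𝓘(ℝ, ℝ) M) : ℝ :=
  connForm D (tangentMap 𝓘(ℝ, ℝ) 𝓘(ℝ, ℝ) ψ p)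
      (mfderiv 𝓘(ℝ, ℝ).tangent 𝓘(ℝ, ℝ).tangent (tangentMap 𝓘(ℝ, ℝ) 𝓘(ℝ, ℝ) ψ) p (horizontal D p))
    - connForm D p (horizontal D p)

/-- The derivative `X f` of a function on the frame bundle. -/
def horizontalDeriv (D : Connection M) (f : TangentBundle 𝓘(ℝ, ℝ) M → ℂ)
    (p : TangentBundle 𝓘(ℝ, ℝ) M) : ℂ :=
  mfderiv 𝓘(ℝ, ℝ).tangent 𝓘(ℝ, ℂ) f p (horizontal D p)

/-- `c` is, near `0`, the curve `t ↦ exp_x(t y)`, the composition of the frame `α = (x, y)` with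
the exponential map of the connection: the geodesic with initial velocity `α`. Geodesics are the
projections of the integral curves of the horizontal vector field. -/
def IsExpCurve (D : Connection M) (α : TangentBundle 𝓘(ℝ, ℝ) M) (c : ℝ → M) : Prop :=
  ∃ b : ℝ → TangentBundle 𝓘(ℝ, ℝ) M, b 0 = α ∧ IsMIntegralCurveAt b (horizontal D) 0 ∧
    c =ᶠ[𝓝 0] fun t => (b t).1

/-! ## The groupoid and the crossed product -/

/-- The members of the pseudogroup are smooth and preserve the orientation. -/
def IsSmoothOriented (Γ : StructureGroupoid M) : Prop :=
  ∀ ψ ∈ Γ, ContMDiffOn 𝓘(ℝ, ℝ) 𝓘(ℝ, ℝ) ∞ ψ ψ.source ∧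
    ∀ x (v : TangentSpace 𝓘(ℝ, ℝ) x), x ∈ ψ.source → (⟨x, v⟩ : TangentBundle 𝓘(ℝ, ℝ) M) ∈ posFrames M →
      tangentMap 𝓘(ℝ, ℝ) 𝓘(ℝ, ℝ) ψ ⟨x, v⟩ ∈ posFrames M

/-- The groupoid `G = F⁺ ⋊ Γ`. An element is given by its range, a positive frame `β`, and by the
germ at the base point of `β` of an element `φ⁻¹` of the pseudogroup; its source is the frame
`α = φ̃⁻¹ β`, and it is the element `(φ, α)` with `φ̃ α = β`. -/
structure FrameGroupoid (Γ : StructureGroupoid M) where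
  range : PosFrame M
  germ : Germ (𝓝 range.1.1) M
  exists_rep : ∃ ψ ∈ Γ, range.1.1 ∈ ψ.source ∧ germ = ((ψ : M → M) : Germ (𝓝 range.1.1) M)

namespace FrameGroupoid

variable {Γ : StructureGroupoid M}

/-- The element `(ψ⁻¹, ψ̃ β)` of the groupoid, with range `β` and source `ψ̃ β`. -/
def mk' (ψ : OpenPartialHomeomorph M M) (hψ : ψ ∈ Γ) (β : PosFrame M)
    (hβ : β.1.1 ∈ ψ.source) : FrameGroupoid Γ :=
  ⟨β, ((ψ : M → M) : Germ (𝓝 β.1.1) M), ψ, hψ, hβ, rfl⟩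

/-- A local diffeomorphism `ψ = φ⁻¹` representing the element `(φ, α)`; only its germ matters. -/
def rep (g : FrameGroupoid Γ) : OpenPartialHomeomorph M M := Classical.choose g.exists_rep

end FrameGroupoid

/-- Functions on the étale groupoid, as families which give at each `g` the germ of a function on
the frame bundle at the range of `g`; the value at `g` is the value of this germ. When the groupoid
is not Hausdorff, finite sums of smooth functions with supports in charts are not
determined by their values to first order, so that the germs are needed for `X` to act. -/
abbrev GroupoidFun (Γ : StructureGroupoid M) : Type _ :=
  (g : FrameGroupoid Γ) → Germ (𝓝 (g.range.1 : TangentBundle 𝓘(ℝ, ℝ) M)) ℂ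

open Classical in
/-- The monomial `f U_ψ^*`: the function `f` of the range on the open set of all `(ψ⁻¹, ψ̃ β)`,
extended by `0`. -/
def monomial (Γ : StructureGroupoid M) (ψ : OpenPartialHomeomorph M M)
    (f : TangentBundle 𝓘(ℝ, ℝ) M → ℂ) : GroupoidFun Γ := fun g =>
  if g.range.1.1 ∈ ψ.source ∧ g.germ = ((ψ : M → M) : Germ (𝓝 g.range.1.1) M) then
    (f : Germ (𝓝 (g.range.1 : TangentBundle 𝓘(ℝ, ℝ) M)) ℂ)
  else 0

/-- `f` is a smooth function with compact support in the frames over the domain of `ψ`. -/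
def IsTestFunction (ψ : OpenPartialHomeomorph M M) (f : TangentBundle 𝓘(ℝ, ℝ) M → ℂ) : Prop :=
  ContMDiff 𝓘(ℝ, ℝ).tangent 𝓘(ℝ, ℂ) ∞ f ∧ HasCompactSupport f ∧
    tsupport f ⊆ {p | p ∈ posFrames M ∧ p.1 ∈ ψ.source}

/-- The crossed product `C_c^∞(G)`: the linear span of the monomials `f U_ψ^*`. -/
def crossedProduct (Γ : StructureGroupoid M) : Submodule ℂ (GroupoidFun Γ) :=
  Submodule.span ℂ {a | ∃ ψ ∈ Γ, ∃ f, IsTestFunction ψ f ∧ a = monomial Γ ψ f}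

/-! ## The action on the crossed product -/

theorem horizontalDeriv_congr (D : Connection M) {p : TangentBundle 𝓘(ℝ, ℝ) M}
    {f f' : TangentBundle 𝓘(ℝ, ℝ) M → ℂ} (h : f =ᶠ[𝓝 p] f') :
    horizontalDeriv D f =ᶠ[𝓝 p] horizontalDeriv D f' := by
  filter_upwards [eventually_eventually_nhds.mpr h] with q hq
  have h1 : f =ᶠ[𝓝 q] f' := hq
  unfold horizontalDeriv
  rw [Filter.EventuallyEq.mfderiv_eq h1]
  rfl

variable {Γ : StructureGroupoid M}

/-- The operator `X`, `X (f U_ψ^*) = (X f) U_ψ^*`. -/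
def opX (D : Connection M) (a : GroupoidFun Γ) : GroupoidFun Γ := fun g =>
  Germ.map' (horizontalDeriv D) (fun _ _ h => horizontalDeriv_congr D h) (a g)

/-- The operator `δ₁`, `δ₁ (f U_ψ^*) = γ^ψ f U_ψ^*`. -/
def opDeltaOne (D : Connection M) (a : GroupoidFun Γ) : GroupoidFun Γ := fun g =>
  ((fun p => (cocycle D g.rep p : ℂ) : TangentBundle 𝓘(ℝ, ℝ) M → ℂ) :
    Germ (𝓝 (g.range.1 : TangentBundle 𝓘(ℝ, ℝ) M)) ℂ) * a g

/-- The operators `δₙ₊₁` on the crossed product: `δₙ₊₁ = [X, δₙ]`. -/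
def opDelta (D : Connection M) : ℕ → GroupoidFun Γ → GroupoidFun Γ
  | 0 => opDeltaOne D
  | n + 1 => fun a => opX D (opDelta D n a) - opDelta D n (opX D a)

/-! ## The canonical homomorphism -/

/-- `γ(φ, α) = exp_{φ̃ α}⁻¹ ∘ φ ∘ exp_α` for all `(φ, α)` in `G`, that is, with `ψ = φ⁻¹` and
`β = φ̃ α`, the germ `θ` of `γ(φ, α)` satisfies `exp_β ∘ θ = φ ∘ exp_{ψ̃ β}`. -/
def IsCanonicalHom (D : Connection M) (γ : FrameGroupoid Γ → DiffeoGerm) : Prop :=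
  ∀ (ψ : OpenPartialHomeomorph M M) (hψ : ψ ∈ Γ) (β : PosFrame M) (hβ : β.1.1 ∈ ψ.source),
    ∃ (θ : DiffeoRep) (cα cβ : ℝ → M), γ (FrameGroupoid.mk' ψ hψ β hβ) = DiffeoGerm.mk θ ∧
      IsExpCurve D (tangentMap 𝓘(ℝ, ℝ) 𝓘(ℝ, ℝ) ψ β.1) cα ∧ IsExpCurve D β.1 cβ ∧
      (cβ ∘ θ.toHomeo) =ᶠ[𝓝 0] (ψ.symm ∘ cα)

end Manifold

end CrossedProduct

end

noncomputable section

namespace CrossedProduct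

/-! ## The generic germ and the comodule matrix -/

/-! The theorem has an algebraic half and a geometric half.

Algebra. Let `Ψ` be the generic germ with `log Ψ' = ∑ δₙ xⁿ / n!`. Its coefficients are Bell
polynomials in the `δₙ`, and `genericMatrix i m` is the coefficient of `x^m` in `Ψ^i`. The
derivations `[X, ·]` and `[Y, ·]` act on `Ψ` as infinitesimal translation and dilation of its
argument, renormalised to keep `Ψ` tangent to the identity: they give `Ψ' - δ₁ Ψ - 1` and `x Ψ' -
Ψ`. With the recursion defining the coproduct this yields `coprod_genericMatrix`, the law of
composition of series in matrix form. Hence `R(L) f = L(f ∘ Ψ)`, taken coefficientwise, is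
multiplicative for `conv`, and its values on the counit and on `Zₖ` are read off from the constant
and linear parts of the Bell polynomials. On a character `R` is substitution into a series. The Bell
polynomials are triangular in the `δₙ`, so a group-like element is determined by that series; it
corresponds to `φ` exactly when it is evaluation at the coordinates of `φ⁻¹` (`corresponds_iff`).

Geometry. Solving `σ'' = Γ σ'` gives charts in which the connection is trivial
(`exists_isAffineChart`): there `X = y ∂_s`, `ω = dy / y`, and geodesics are affine. If `ψ` reads as
`h` in such charts, then `γ^ψ = y h'' / h'`. The commutator of `X` with multiplication by a function
is multiplication by its `X`-derivative, so `δₙ₊₁` multiplies by `y^(n+1) (h''/h')⁽ⁿ⁾`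
(`opDelta_apply`). The germ `exp_{ψ̃ β}⁻¹ ∘ ψ ∘ exp_β` is `h` between two affine maps, and its
coordinates are the same expression (`coord_rep`). Since exponential maps are locally injective, the
formula for `γ(g)` has a unique solution, the inverse of this germ (`isCanonicalGerm_iff`). -/

/-- The complete Bell polynomials: `(d/dx)ⁿ exp u = Bₙ(u', u'', …) exp u`. -/
def bell : ℕ → HopfAlg
  | 0 => 1
  | n + 1 => adX (bell n) + hopfDelta 0 * bell n

/-- The Taylor series of the germ `ψ` with `log ψ' = ∑ δₙ xⁿ / n!`. -/
def genericSeries : PowerSeries HopfAlg :=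
  PowerSeries.mk fun m => Nat.casesOn m 0 fun n => (((n + 1).factorial : ℝ)⁻¹) • bell n

/-- The coefficients of the powers of the generic germ. -/
def genericMatrix (i m : ℕ) : HopfAlg := PowerSeries.coeff m (genericSeries ^ i)

/-- A derivation applied to each coefficient of a power series. -/
def coeffDerivation (d : Derivation ℝ HopfAlg HopfAlg) (f : PowerSeries HopfAlg) :
    PowerSeries HopfAlg :=
  PowerSeries.mk fun m => d (PowerSeries.coeff m f)

theorem coeffDerivation_one (d : Derivation ℝ HopfAlg HopfAlg) : coeffDerivation d 1 = 0 := by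
  ext1 m
  simp only [coeffDerivation, PowerSeries.coeff_mk, PowerSeries.coeff_one]
  split_ifs <;> simp

theorem coeffDerivation_mul (d : Derivation ℝ HopfAlg HopfAlg) (f g : PowerSeries HopfAlg) :
    coeffDerivation d (f * g) = coeffDerivation d f * g + f * coeffDerivation d g := by
  ext1 m
  simp only [coeffDerivation, PowerSeries.coeff_mk, PowerSeries.coeff_mul, map_add, map_sum,
    ← Finset.sum_add_distrib, Derivation.leibniz, smul_eq_mul]
  refine Finset.sum_congr rfl fun p _ => ?_
  ring

theorem coeffDerivation_pow (d : Derivation ℝ HopfAlg HopfAlg) (f : PowerSeries HopfAlg) (i : ℕ) :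
    coeffDerivation d (f ^ i) = i * f ^ (i - 1) * coeffDerivation d f := by
  induction i with
  | zero => simp [coeffDerivation_one]
  | succ i ih =>
    rw [pow_succ, coeffDerivation_mul, ih]
    rcases i with _ | i
    · simp
    · simp only [Nat.add_sub_cancel]
      push_cast
      ring

theorem coeff_zero_genericSeries : PowerSeries.coeff 0 genericSeries = 0 := by
  simp [genericSeries]

theorem coeff_succ_genericSeries (n : ℕ) :
    PowerSeries.coeff (n + 1) genericSeries = (((n + 1).factorial : ℝ)⁻¹) • bell n := by
  simp [genericSeries]

/-- This is `[Y, X] = X`; commutators of derivations are derivations, so generators suffice. -/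
theorem adY_adX (P : HopfAlg) : adY (adX P) = adX (adY P) + adX P := by
  have h : ⁅adY, adX⁆ = adX := by
    refine MvPolynomial.derivation_ext fun n => ?_
    rw [Derivation.commutator_apply]
    simp only [adX, adY, MvPolynomial.mkDerivation_X, hopfDelta, Derivation.map_smul]
    rw [← sub_smul]
    push_cast
    ring_nf
    simp
  have h' := congrArg (fun d => d P) h
  simp only [Derivation.commutator_apply] at h'
  exact sub_eq_iff_eq_add'.mp h'

/-- `adY` multiplies by the weight, where `δₙ` has weight `n`; both terms of the Bell recursion
raise the weight by one. -/
theorem adY_bell (n : ℕ) : adY (bell n) = (n : ℝ) • bell n := by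
  induction n with
  | zero => simp [bell]
  | succ n ih =>
    have h0 : adY (hopfDelta 0) = hopfDelta 0 := by
      simp [adY, hopfDelta]
    simp only [bell, map_add, adY_adX, ih, Derivation.leibniz, smul_eq_mul, h0,
      Derivation.map_smul]
    simp only [MvPolynomial.smul_eq_C_mul]
    push_cast
    rw [map_add, map_one]
    ring

/-- Coefficientwise this is the Bell recursion; the `1` removes `bell 0`, the constant term of the
derivative. It is the derivative at `s = 0` of `(Ψ(s + x) - Ψ(s)) / Ψ'(s)`, the germ seen from a
moving base point. -/
theorem coeffDerivation_adX_genericSeries :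
    coeffDerivation adX genericSeries = PowerSeries.derivative HopfAlg genericSeries
      - PowerSeries.C (hopfDelta 0) * genericSeries - 1 := by
  ext1 m
  simp only [coeffDerivation, PowerSeries.coeff_mk, map_sub, PowerSeries.coeff_derivative,
    PowerSeries.coeff_C_mul, PowerSeries.coeff_one]
  have hfac : ∀ n : ℕ, (((n + 1).factorial : ℝ)⁻¹) * ((n : ℝ) + 1) = (n.factorial : ℝ)⁻¹ := by
    intro n
    rw [Nat.factorial_succ]
    push_cast
    field_simp
  have hmul : ∀ n : ℕ, PowerSeries.coeff (n + 1) genericSeries * ((n : HopfAlg) + 1)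
      = ((n.factorial : ℝ)⁻¹) • bell n := by
    intro n
    rw [coeff_succ_genericSeries, ← hfac n, MvPolynomial.smul_eq_C_mul, MvPolynomial.smul_eq_C_mul,
      map_mul, map_add, map_one, map_natCast]
    ring
  rw [hmul]
  rcases m with _ | m
  · simp [coeff_zero_genericSeries, bell]
  · rw [coeff_succ_genericSeries, Derivation.map_smul]
    simp only [bell, smul_add, Nat.succ_ne_zero, if_false, mul_smul_comm]
    ring

/-- Infinitesimal form of `Ψ(x) ↦ c⁻¹ Ψ(c x)`, which multiplies `δₙ` by `cⁿ`. -/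
theorem coeffDerivation_adY_genericSeries :
    coeffDerivation adY genericSeries =
      PowerSeries.X * PowerSeries.derivative HopfAlg genericSeries - genericSeries := by
  ext1 m
  rcases m with _ | m
  · rw [map_sub, PowerSeries.coeff_zero_X_mul]
    simp [coeffDerivation, coeff_zero_genericSeries]
  · simp only [coeffDerivation, PowerSeries.coeff_mk, map_sub, PowerSeries.coeff_derivative,
      PowerSeries.coeff_succ_X_mul]
    rw [coeff_succ_genericSeries, Derivation.map_smul, adY_bell]
    simp only [MvPolynomial.smul_eq_C_mul, map_natCast]
    ring

theorem genericMatrix_zero (i : ℕ) : genericMatrix i 0 = if i = 0 then 1 else 0 := by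
  have h : PowerSeries.constantCoeff genericSeries = 0 := by
    rw [← PowerSeries.coeff_zero_eq_constantCoeff_apply, coeff_zero_genericSeries]
  simp [genericMatrix, h, zero_pow_eq]

theorem genericMatrix_of_lt {i m : ℕ} (h : m < i) : genericMatrix i m = 0 := by
  have hX : PowerSeries.X ∣ genericSeries := by
    rw [PowerSeries.X_dvd_iff, ← PowerSeries.coeff_zero_eq_constantCoeff_apply,
      coeff_zero_genericSeries]
  exact PowerSeries.X_pow_dvd_iff.mp (pow_dvd_pow_of_dvd hX i) m h

/-- The powers of `Ψ` inherit its differential equation. Solved for `genericMatrix i (m + 1)`, it is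
a recursion in `m`. The truncated `i - 1` is harmless at `i = 0`, where its factor `i` vanishes. -/
theorem adX_genericMatrix (i m : ℕ) :
    adX (genericMatrix i m) = ((m : ℝ) + 1) • genericMatrix i (m + 1)
      - (i : ℝ) • (hopfDelta 0 * genericMatrix i m) - (i : ℝ) • genericMatrix (i - 1) m := by
  have h : coeffDerivation adX (genericSeries ^ i) =
      PowerSeries.derivative HopfAlg (genericSeries ^ i)
        - PowerSeries.C (hopfDelta 0) * ((i : PowerSeries HopfAlg) * genericSeries ^ i)
        - (i : PowerSeries HopfAlg) * genericSeries ^ (i - 1) := by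
    rw [coeffDerivation_pow, coeffDerivation_adX_genericSeries, PowerSeries.derivative_pow]
    rcases i with _ | i
    · simp
    · simp only [Nat.add_sub_cancel]
      ring
  have h' := congrArg (PowerSeries.coeff m) h
  have hi : (i : PowerSeries HopfAlg) = PowerSeries.C (i : HopfAlg) := by simp
  rw [hi] at h'
  simp only [map_sub, PowerSeries.coeff_derivative, PowerSeries.coeff_C_mul] at h'
  simp only [coeffDerivation, PowerSeries.coeff_mk] at h'
  simp only [genericMatrix, MvPolynomial.smul_eq_C_mul, map_natCast, map_add, map_one]
  rw [h']
  ring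

theorem adY_genericMatrix (i m : ℕ) :
    adY (genericMatrix i m) = ((m : ℝ) - i) • genericMatrix i m := by
  have h : coeffDerivation adY (genericSeries ^ i) =
      PowerSeries.X * PowerSeries.derivative HopfAlg (genericSeries ^ i)
        - (i : PowerSeries HopfAlg) * genericSeries ^ i := by
    rw [coeffDerivation_pow, coeffDerivation_adY_genericSeries, PowerSeries.derivative_pow]
    rcases i with _ | i
    · simp
    · simp only [Nat.add_sub_cancel]
      ring
  have h' := congrArg (PowerSeries.coeff m) h
  have hi : (i : PowerSeries HopfAlg) = PowerSeries.C (i : HopfAlg) := by simp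
  rw [hi] at h'
  simp only [map_sub, PowerSeries.coeff_C_mul] at h'
  simp only [coeffDerivation, PowerSeries.coeff_mk] at h'
  simp only [genericMatrix, MvPolynomial.smul_eq_C_mul, map_natCast, map_sub]
  rw [h']
  rcases m with _ | m
  · simp
  · rw [PowerSeries.coeff_succ_X_mul, PowerSeries.coeff_derivative]
    push_cast
    ring

/-! ## The coproduct of the comodule matrix -/

theorem adCoprodX_tmul (a b : HopfAlg) :
    adCoprodX (a ⊗ₜ[ℝ] b) = adX a ⊗ₜ[ℝ] b + a ⊗ₜ[ℝ] adX b + (hopfDelta 0 * a) ⊗ₜ[ℝ] adY b := by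
  simp [adCoprodX]

/-- Each summand of `adCoprodX` is a derivation; the last one is `1 ⊗ adY` multiplied by the element
`δ₁ ⊗ 1` of a commutative algebra. -/
theorem adCoprodX_mul (s t : HopfAlg ⊗[ℝ] HopfAlg) :
    adCoprodX (s * t) = adCoprodX s * t + s * adCoprodX t := by
  induction s with
  | zero => simp
  | add s s' hs hs' => simp only [add_mul, map_add, hs, hs']; ring
  | tmul a b =>
    induction t with
    | zero => simp
    | add t t' ht ht' => simp only [mul_add, map_add, ht, ht']; ring
    | tmul a' b' =>
      simp only [Algebra.TensorProduct.tmul_mul_tmul, adCoprodX_tmul, Derivation.leibniz,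
        smul_eq_mul, add_mul, mul_add, TensorProduct.add_tmul, TensorProduct.tmul_add]
      rw [mul_comm b' (adX b), mul_comm a' (adX a), mul_comm b' (adY b),
        show hopfDelta 0 * a * a' = hopfDelta 0 * (a * a') by ring,
        show a * (hopfDelta 0 * a') = hopfDelta 0 * (a * a') by ring]
      abel

/-- Both sides obey the Leibniz rule along `coprod`, and on generators they agree by the recursion
defining `coprodDelta`. -/
theorem coprod_adX (P : HopfAlg) : coprod (adX P) = adCoprodX (coprod P) := by
  induction P using MvPolynomial.induction_on with
  | C r =>
    have h1 : coprod (MvPolynomial.C r) = r • ((1 : HopfAlg) ⊗ₜ[ℝ] (1 : HopfAlg)) := by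
      rw [← MvPolynomial.algebraMap_eq, AlgHom.commutes, Algebra.algebraMap_eq_smul_one]
      rfl
    rw [h1, map_smul, adCoprodX_tmul]
    simp [← MvPolynomial.algebraMap_eq]
  | add p q hp hq => simp only [map_add, hp, hq]
  | mul_X p n hp =>
    have h1 : adX (MvPolynomial.X n) = hopfDelta (n + 1) := by simp [adX]
    have h2 : ∀ k, coprod (MvPolynomial.X k) = coprodDelta k := by simp [coprod]
    simp only [Derivation.leibniz, smul_eq_mul, map_add, map_mul, hp, h1, adCoprodX_mul]
    rw [hopfDelta, h2, h2]
    change _ = _ + coprod p * coprodDelta (n + 1)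
    ring

/-- The coefficient matrix of a composed series is a product of matrices. The proof applies `coprod`
to the recursion in `m`. Any bound `N > m` is allowed because `genericMatrix j m = 0` for `j > m`,
so the same `N` serves for `m` and `m + 1`. -/
theorem coprod_genericMatrix (m : ℕ) : ∀ i N : ℕ, m < N → coprod (genericMatrix i m) =
    ∑ j ∈ Finset.range N, genericMatrix j m ⊗ₜ[ℝ] genericMatrix i j := by
  induction m with
  | zero =>
    intro i N hN
    rw [Finset.sum_eq_single_of_mem 0 (Finset.mem_range.mpr hN)]
    · simp only [genericMatrix_zero, if_true]
      split_ifs <;> simp [Algebra.TensorProduct.one_def]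
    · intro j _ hj
      simp [genericMatrix_zero, hj]
  | succ m ih =>
    intro i N hN
    have hm : m < N := by omega
    have hne : ((m : ℝ) + 1) ≠ 0 := by positivity
    have key : ((m : ℝ) + 1) • genericMatrix i (m + 1) = adX (genericMatrix i m)
        + (i : ℝ) • (hopfDelta 0 * genericMatrix i m) + (i : ℝ) • genericMatrix (i - 1) m := by
      rw [adX_genericMatrix]; abel
    have hδ : coprod (hopfDelta 0) = hopfDelta 0 ⊗ₜ[ℝ] 1 + 1 ⊗ₜ[ℝ] hopfDelta 0 := by
      simp [coprod, hopfDelta, coprodDelta]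
    -- `adX` on the left factor produces the first sum with a minus sign, `adX` on the right factor
    -- produces the second one, and they must cancel. Reindexing loses only the last term, which is
    -- zero since `m < K`.
    have shift : ∑ j ∈ Finset.range N, (j : ℝ) • (genericMatrix (j - 1) m ⊗ₜ[ℝ] genericMatrix i j)
        = ∑ j ∈ Finset.range N,
          ((j : ℝ) + 1) • (genericMatrix j m ⊗ₜ[ℝ] genericMatrix i (j + 1)) := by
      obtain ⟨K, rfl⟩ : ∃ K, N = K + 1 := ⟨N - 1, by omega⟩
      rw [Finset.sum_range_succ' _ K, Finset.sum_range_succ _ K,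
        genericMatrix_of_lt (show m < K by omega)]
      simp
    have h := congrArg coprod key
    simp only [map_add, map_smul, map_mul, coprod_adX, ih _ N hm, map_sum, adCoprodX_tmul, hδ] at h
    have h2 : ((m : ℝ) + 1) • coprod (genericMatrix i (m + 1)) = ((m : ℝ) + 1) •
        ∑ j ∈ Finset.range N, genericMatrix j (m + 1) ⊗ₜ[ℝ] genericMatrix i j := by
      rw [h, ← sub_eq_zero]
      have shift' := sub_eq_zero.mpr shift.symm
      -- The zero is replaced by the vanishing difference of the shifted sums, after which the
      -- identity holds term by term in `j`.
      rw [← shift']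
      simp only [Finset.smul_sum, Finset.mul_sum, ← Finset.sum_add_distrib,
        ← Finset.sum_sub_distrib]
      rw [← sub_eq_zero, ← Finset.sum_sub_distrib]
      refine Finset.sum_eq_zero fun j _ => ?_
      simp only [adX_genericMatrix, adY_genericMatrix, add_mul, Algebra.TensorProduct.tmul_mul_tmul,
        one_mul, TensorProduct.sub_tmul, TensorProduct.tmul_sub, TensorProduct.tmul_smul,
        ← TensorProduct.smul_tmul']
      module
    exact smul_right_injective _ hne h2

/-! ## The action on formal power series -/

/-- The action of linear forms on formal power series, `R(L) f = (L ⊗ 1)(f ∘ Ψ)` with the generic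
germ `Ψ`. -/
def functionAction : DualAlg →ₗ[ℝ] (PowerSeries ℝ →ₗ[ℝ] PowerSeries ℝ) :=
  LinearMap.mk₂ ℝ
    (fun L f => PowerSeries.mk fun m =>
      ∑ i ∈ Finset.range (m + 1), PowerSeries.coeff i f * L (genericMatrix i m))
    (fun L L' f => by
      ext1 m
      simp [mul_add, Finset.sum_add_distrib])
    (fun c L f => by
      ext1 m
      simp [Finset.mul_sum, mul_left_comm])
    (fun L f f' => by
      ext1 m
      simp [add_mul, Finset.sum_add_distrib])
    (fun c L f => by
      ext1 m
      simp [Finset.mul_sum, mul_assoc])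

theorem coeff_functionAction (L : DualAlg) (f : PowerSeries ℝ) (m : ℕ) :
    PowerSeries.coeff m (functionAction L f) =
      ∑ i ∈ Finset.range (m + 1), PowerSeries.coeff i f * L (genericMatrix i m) := by
  simp [functionAction]

theorem coeff_functionAction_of_lt (L : DualAlg) (f : PowerSeries ℝ) {m N : ℕ} (h : m < N) :
    PowerSeries.coeff m (functionAction L f) =
      ∑ i ∈ Finset.range N, PowerSeries.coeff i f * L (genericMatrix i m) := by
  rw [coeff_functionAction]
  refine Finset.sum_subset (fun i hi => ?_) fun i _ hi => ?_
  · simp only [Finset.mem_range] at hi ⊢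
    omega
  · rw [genericMatrix_of_lt (by simpa using hi)]
    simp

theorem conv_genericMatrix (L L' : DualAlg) {i m N : ℕ} (h : m < N) :
    conv L L' (genericMatrix i m) =
      ∑ j ∈ Finset.range N, L (genericMatrix j m) * L' (genericMatrix i j) := by
  change (TensorProduct.lid ℝ ℝ) (TensorProduct.map L L' (coprod (genericMatrix i m))) = _
  rw [coprod_genericMatrix m i N h]
  simp

theorem functionAction_conv (L L' : DualAlg) :
    functionAction (conv L L') = functionAction L ∘ₗ functionAction L' := by
  ext f m
  rw [LinearMap.comp_apply, coeff_functionAction, coeff_functionAction]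
  have h1 : ∀ i ∈ Finset.range (m + 1),
      PowerSeries.coeff i f * conv L L' (genericMatrix i m) = ∑ j ∈ Finset.range (m + 1),
        PowerSeries.coeff i f * (L (genericMatrix j m) * L' (genericMatrix i j)) := by
    intro i _
    rw [conv_genericMatrix L L' (Nat.lt_succ_self m), Finset.mul_sum]
  rw [Finset.sum_congr rfl h1, Finset.sum_comm]
  refine Finset.sum_congr rfl fun j hj => ?_
  rw [coeff_functionAction_of_lt L' f (Finset.mem_range.mp hj), Finset.sum_mul]
  refine Finset.sum_congr rfl fun i _ => ?_
  ring

/-- The augmentation as an algebra homomorphism. -/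
def counitHom : HopfAlg →ₐ[ℝ] ℝ := MvPolynomial.aeval fun _ : ℕ => (0 : ℝ)

theorem counitHom_hopfDelta (n : ℕ) : counitHom (hopfDelta n) = 0 := by
  simp [counitHom, hopfDelta]

/-- `adX` kills constants and sends generators to generators, so its image lies in the augmentation
ideal. -/
theorem counitHom_adX (P : HopfAlg) : counitHom (adX P) = 0 := by
  induction P using MvPolynomial.induction_on with
  | C r => simp [← MvPolynomial.algebraMap_eq]
  | add p q hp hq => simp [hp, hq]
  | mul_X p n hp =>
    have h1 : adX (MvPolynomial.X n) = hopfDelta (n + 1) := by simp [adX]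
    have h2 : counitHom (MvPolynomial.X n) = 0 := counitHom_hopfDelta n
    simp [Derivation.leibniz, hp, h1, h2, counitHom_hopfDelta]

theorem counitHom_bell (n : ℕ) : counitHom (bell n) = if n = 0 then 1 else 0 := by
  rcases n with _ | n
  · simp [bell]
  · simp [bell, counitHom_adX, counitHom_hopfDelta]

theorem map_counitHom_genericSeries :
    PowerSeries.map (counitHom : HopfAlg →+* ℝ) genericSeries = PowerSeries.X := by
  ext m
  rcases m with _ | m
  · simp [coeff_zero_genericSeries]
  · simp only [PowerSeries.coeff_map, coeff_succ_genericSeries, PowerSeries.coeff_X,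
      RingHom.coe_coe, map_smul, counitHom_bell]
    rcases m with _ | m <;> simp

theorem character_genericMatrix (χ : HopfAlg →ₐ[ℝ] ℝ) (i m : ℕ) :
    χ (genericMatrix i m) =
      PowerSeries.coeff m (PowerSeries.map (χ : HopfAlg →+* ℝ) genericSeries ^ i) := by
  rw [← map_pow, PowerSeries.coeff_map]
  rfl

theorem functionAction_counit : functionAction counit = LinearMap.id := by
  ext f m
  rw [coeff_functionAction]
  have h : ∀ i, counit (genericMatrix i m) = if m = i then 1 else 0 := by
    intro i
    change counitHom (genericMatrix i m) = _
    rw [character_genericMatrix, map_counitHom_genericSeries, PowerSeries.coeff_X_pow]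
  simp [h]

theorem dualZ_mul (k : ℕ) (P Q : HopfAlg) :
    dualZ k (P * Q) = dualZ k P * counitHom Q + counitHom P * dualZ k Q := by
  change counitHom _ = counitHom _ * _ + _ * counitHom _
  simp only [Derivation.coeFn_coe, Derivation.leibniz, smul_eq_mul, map_add, map_mul]
  ring

theorem dualZ_hopfDelta (k n : ℕ) : dualZ k (hopfDelta n) = if n = k then 1 else 0 := by
  change counitHom (MvPolynomial.pderiv k (MvPolynomial.X n)) = _
  rw [MvPolynomial.pderiv_X]
  by_cases h : n = k
  · subst h; simp
  · simp [h]

/-- Only the linear part of `P` matters, and there `adX` shifts the variables by one. -/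
theorem dualZ_adX (k : ℕ) (P : HopfAlg) :
    dualZ k (adX P) = Nat.casesOn k 0 fun j => dualZ j P := by
  induction P using MvPolynomial.induction_on with
  | C r =>
    rcases k with _ | k <;> simp [← MvPolynomial.algebraMap_eq, dualZ]
  | add p q hp hq => rcases k with _ | k <;> simp_all
  | mul_X p n hp =>
    have h1 : adX (MvPolynomial.X n) = hopfDelta (n + 1) := by simp [adX]
    have h2 : counitHom (MvPolynomial.X n) = 0 := counitHom_hopfDelta n
    have h3 : ∀ j, dualZ j (MvPolynomial.X n) = _ := fun j => dualZ_hopfDelta j n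
    simp only [Derivation.leibniz, h1, smul_eq_mul, map_add, dualZ_mul, counitHom_adX, h2,
      counitHom_hopfDelta, dualZ_hopfDelta]
    rcases k with _ | k
    · simp
    · simp [h3]

/-- The linear part of `bell n` is `δₙ`, the variable with index `n - 1`. -/
theorem dualZ_bell (k n : ℕ) : dualZ k (bell n) = if n = k + 1 then 1 else 0 := by
  induction n generalizing k with
  | zero => simp [bell, dualZ]
  | succ n ih =>
    rw [bell, map_add, dualZ_mul, dualZ_adX, dualZ_hopfDelta, counitHom_hopfDelta, counitHom_bell]
    rcases k with _ | k
    · simp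
    · simp [ih]

/-- `Ψ^i` is differentiated in the variable `k` and all variables are then set to `0`. There `Ψ =
x`, and by `dualZ_bell` the derivative of `Ψ` is `x^(k+2) / (k+2)!`. -/
theorem dualZ_genericMatrix (k i m : ℕ) : dualZ k (genericMatrix i m) =
    PowerSeries.coeff m (PowerSeries.C (((k + 2).factorial : ℝ)⁻¹) *
      ((i : PowerSeries ℝ) * PowerSeries.X ^ (i - 1) * PowerSeries.X ^ (k + 2))) := by
  have h : PowerSeries.map (counitHom : HopfAlg →+* ℝ)
      (coeffDerivation (MvPolynomial.pderiv k) (genericSeries ^ i)) =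
        (i : PowerSeries ℝ) * PowerSeries.X ^ (i - 1) *
          (PowerSeries.C (((k + 2).factorial : ℝ)⁻¹) * PowerSeries.X ^ (k + 2)) := by
    rw [coeffDerivation_pow]
    simp only [map_mul, map_pow, map_natCast, map_counitHom_genericSeries]
    congr 1
    ext m
    simp only [PowerSeries.coeff_map, coeffDerivation, PowerSeries.coeff_mk,
      PowerSeries.coeff_C_mul, PowerSeries.coeff_X_pow]
    change dualZ k _ = _
    rcases m with _ | m
    · simp [coeff_zero_genericSeries]
    · rw [coeff_succ_genericSeries, map_smul, dualZ_bell]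
      by_cases hm : m = k + 1
      · subst hm; simp
      · simp [hm]
  have h' := congrArg (PowerSeries.coeff m) h
  simp only [PowerSeries.coeff_map, coeffDerivation, PowerSeries.coeff_mk] at h'
  change dualZ k (genericMatrix i m) = _ at h'
  rw [h']
  congr 1
  ring

theorem functionAction_dualZ (k : ℕ) (f : PowerSeries ℝ) : functionAction (dualZ k) f =
    (((k + 2).factorial : ℝ)⁻¹) • (PowerSeries.X ^ (k + 2) * PowerSeries.derivative ℝ f) := by
  ext m
  rw [coeff_functionAction]
  simp only [dualZ_genericMatrix, PowerSeries.coeff_C_mul, map_smul, smul_eq_mul]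
  simp only [mul_left_comm _ (((k + 2).factorial : ℝ)⁻¹), ← Finset.mul_sum]
  congr 1
  have h1 : ∀ i : ℕ, PowerSeries.coeff m ((i : PowerSeries ℝ) * PowerSeries.X ^ (i - 1) *
      PowerSeries.X ^ (k + 2)) = if m = i - 1 + (k + 2) then (i : ℝ) else 0 := by
    intro i
    have hi : (i : PowerSeries ℝ) = PowerSeries.C (i : ℝ) := by simp
    rw [mul_assoc, ← pow_add, hi, PowerSeries.coeff_C_mul, PowerSeries.coeff_X_pow]
    simp
  simp only [h1]
  rw [PowerSeries.coeff_X_pow_mul']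
  split_ifs with hm
  · rw [Finset.sum_eq_single_of_mem (m - (k + 2) + 1) (Finset.mem_range.mpr (by omega)),
      PowerSeries.coeff_derivative, if_pos (by omega)]
    · push_cast; ring
    · intro i _ hi
      -- For `m = k + 2` the index `i = 0` also passes the test, as `0 - 1 = 0`, but it carries the
      -- factor `0`.
      rcases i with _ | i
      · simp
      · rw [if_neg (by omega), mul_zero]
  · refine Finset.sum_eq_zero fun i _ => ?_
    rw [if_neg (by omega), mul_zero]

theorem isFunctionAction_functionAction : IsFunctionAction functionAction where
  map_one := functionAction_counit
  map_mul := functionAction_conv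
  map_Z := functionAction_dualZ
  continuous f m := ⟨∑ i ∈ Finset.range (m + 1), PowerSeries.coeff i f • genericMatrix i m,
    fun L => by simp [coeff_functionAction]⟩

/-- A multiplicative form commutes with taking powers of `Ψ`; the sum for substitution stops at `m`
because the generic matrix is triangular. -/
theorem functionAction_character (χ : HopfAlg →ₐ[ℝ] ℝ) (f : PowerSeries ℝ) :
    functionAction χ.toLinearMap f =
      PowerSeries.subst (PowerSeries.map (χ : HopfAlg →+* ℝ) genericSeries) f := by
  have h0 : PowerSeries.constantCoeff (PowerSeries.map (χ : HopfAlg →+* ℝ) genericSeries) = 0 := by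
    rw [← PowerSeries.coeff_zero_eq_constantCoeff_apply, PowerSeries.coeff_map,
      coeff_zero_genericSeries, map_zero]
  ext m
  rw [coeff_functionAction, PowerSeries.coeff_subst' (.of_constantCoeff_zero' h0)]
  rw [finsum_eq_sum_of_support_subset (s := Finset.range (m + 1))]
  · refine Finset.sum_congr rfl fun i _ => ?_
    rw [← character_genericMatrix]
    rfl
  · intro i hi
    by_contra hm
    refine hi ?_
    dsimp only
    rw [← character_genericMatrix, genericMatrix_of_lt (by simpa using hm)]
    simp

/-! ## Group-like elements and germs -/

/-- Triangularity, by which a character is recovered from its values on the Bell polynomials. In the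
recursion only `adX` reaches a new variable; the product with `δ₁` stays among the old ones. -/
theorem bell_succ_eq (n : ℕ) : ∃ Q ∈ MvPolynomial.supported ℝ (Set.Iio n),
    bell (n + 1) = hopfDelta n + Q := by
  have hX : ∀ n, ∀ Q ∈ MvPolynomial.supported ℝ (Set.Iio n),
      adX Q ∈ MvPolynomial.supported ℝ (Set.Iio (n + 1)) := by
    intro n Q hQ
    have hle := MvPolynomial.supported_mono (R := ℝ) (Set.Iio_subset_Iio (Nat.le_succ n))
    rw [MvPolynomial.supported_eq_adjoin_X] at hQ
    have hQ' : Q ∈ MvPolynomial.supported ℝ (Set.Iio n) := hQ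
    induction hQ using Algebra.adjoin_induction with
    | mem x hx =>
      obtain ⟨i, hi, rfl⟩ := hx
      have h1 : adX (MvPolynomial.X i) = MvPolynomial.X (i + 1) := by simp [adX, hopfDelta]
      rw [h1, MvPolynomial.X_mem_supported]
      simpa using hi
    | algebraMap r => simp
    | add x y hx hy ihx ihy =>
      rw [map_add]
      exact add_mem (ihx hx) (ihy hy)
    | mul x y hx hy ihx ihy =>
      rw [Derivation.leibniz]
      exact add_mem (mul_mem (hle hx) (ihy hy)) (mul_mem (hle hy) (ihx hx))
  induction n with
  | zero => exact ⟨0, zero_mem _, by simp [bell]⟩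
  | succ n ih =>
    obtain ⟨Q, hQ, h⟩ := ih
    have hle := MvPolynomial.supported_mono (R := ℝ) (Set.Iio_subset_Iio (Nat.le_succ n))
    refine ⟨adX Q + hopfDelta 0 * bell (n + 1), add_mem (hX n Q hQ) (mul_mem ?_ ?_), ?_⟩
    · exact (MvPolynomial.X_mem_supported).mpr (by simp)
    · rw [h]
      exact add_mem ((MvPolynomial.X_mem_supported).mpr (by simp)) (hle hQ)
    · have h1 : adX (hopfDelta n) = hopfDelta (n + 1) := by simp [adX, hopfDelta]
      rw [bell, h, map_add, h1]
      ring

/-- A character is determined by its values on the Bell polynomials. -/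
theorem character_ext_bell {χ χ' : HopfAlg →ₐ[ℝ] ℝ} (h : ∀ n, χ (bell n) = χ' (bell n)) :
    χ = χ' := by
  refine MvPolynomial.algHom_ext fun n => ?_
  induction n using Nat.strong_induction_on with
  | _ n ih =>
    obtain ⟨Q, hQ, hb⟩ := bell_succ_eq n
    have hQ' : χ Q = χ' Q := by
      rw [MvPolynomial.supported_eq_adjoin_X] at hQ
      have hle : Algebra.adjoin ℝ (MvPolynomial.X '' Set.Iio n) ≤ AlgHom.equalizer χ χ' :=
        Algebra.adjoin_le (by rintro _ ⟨i, hi, rfl⟩; exact ih i hi)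
      exact hle hQ
    have := h (n + 1)
    rw [hb, map_add, map_add, hQ'] at this
    exact add_right_cancel this

/-! ### Derivatives of exponentials and Taylor series of germs -/

theorem contDiffAt_deriv {E : Type*} [NormedAddCommGroup E] [NormedSpace ℝ E] {f : ℝ → E} {x : ℝ}
    (h : ContDiffAt ℝ ∞ f x) : ContDiffAt ℝ ∞ (deriv f) x :=
  (h.fderiv_right (m := ∞) (by simp)).clm_apply contDiffAt_const

theorem contDiffAt_iteratedDeriv {E : Type*} [NormedAddCommGroup E] [NormedSpace ℝ E] {f : ℝ → E}
    {x : ℝ} (h : ContDiffAt ℝ ∞ f x) (n : ℕ) : ContDiffAt ℝ ∞ (iteratedDeriv n f) x := by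
  induction n with
  | zero => simpa using h
  | succ n ih =>
    rw [iteratedDeriv_succ]
    exact contDiffAt_deriv ih

/-- If `f = exp u` then `f⁽ⁿ⁾(t) = Bₙ(u'(t), u''(t), …) f(t)`. -/
theorem iteratedDeriv_exp_eq_bell {f u : ℝ → ℝ} {s : Set ℝ} (hs : IsOpen s)
    (hu : ContDiffOn ℝ ∞ u s) (hf : ∀ t ∈ s, f t = Real.exp (u t)) (n : ℕ) :
    ∀ t ∈ s, iteratedDeriv n f t =
      MvPolynomial.aeval (fun k => iteratedDeriv (k + 1) u t) (bell n) * f t := by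
  have hd : ∀ k, ∀ t ∈ s, HasDerivAt (iteratedDeriv k u) (iteratedDeriv (k + 1) u t) t := by
    intro k t ht
    have h1 : ContDiffAt ℝ ∞ u t := hu.contDiffAt (hs.mem_nhds ht)
    have h2 : DifferentiableAt ℝ (iteratedDeriv k u) t :=
      (contDiffAt_iteratedDeriv h1 k).differentiableAt (by simp)
    rw [iteratedDeriv_succ]
    exact h2.hasDerivAt
  -- Evaluating each `δₖ` at `u⁽ᵏ⁾(t)` turns `adX` into `d/dt`.
  have hP : ∀ P : HopfAlg, ∀ t ∈ s, HasDerivAt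
      (fun t => MvPolynomial.aeval (fun k => iteratedDeriv (k + 1) u t) P)
      (MvPolynomial.aeval (fun k => iteratedDeriv (k + 1) u t) (adX P)) t := by
    intro P t ht
    induction P using MvPolynomial.induction_on with
    | C r =>
      simp only [← MvPolynomial.algebraMap_eq, AlgHom.commutes]
      simpa using hasDerivAt_const t _
    | add p q hp hq => simpa using hp.fun_add hq
    | mul_X p k hp =>
      have h1 : adX (MvPolynomial.X k) = hopfDelta (k + 1) := by simp [adX]
      have h3 := hp.fun_mul (hd (k + 1) t ht)
      simp only [map_mul, MvPolynomial.aeval_X, Derivation.leibniz, map_add, smul_eq_mul, h1,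
        hopfDelta]
      refine h3.congr_deriv ?_
      ring
  induction n with
  | zero => simp [bell]
  | succ n ih =>
    intro t ht
    have h1 : iteratedDeriv n f =ᶠ[𝓝 t]
        fun t => MvPolynomial.aeval (fun k => iteratedDeriv (k + 1) u t) (bell n) * f t := by
      filter_upwards [hs.mem_nhds ht] with r hr using ih r hr
    have h2 : f =ᶠ[𝓝 t] fun t => Real.exp (u t) := by
      filter_upwards [hs.mem_nhds ht] with r hr using hf r hr
    have h3 : HasDerivAt f (iteratedDeriv 1 u t * f t) t := by
      have h4 := (hd 0 t ht)
      rw [iteratedDeriv_zero] at h4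
      refine (h4.exp.congr_of_eventuallyEq h2).congr_deriv ?_
      rw [hf t ht]
      ring
    rw [iteratedDeriv_succ, h1.deriv_eq, ((hP (bell n) t ht).fun_mul h3).deriv]
    simp only [bell, map_add, map_mul, hopfDelta, MvPolynomial.aeval_X]
    ring

/-- The character of the Hopf algebra with the coordinates of a germ. -/
def germCharacter (φ : DiffeoGerm) : HopfAlg →ₐ[ℝ] ℝ :=
  MvPolynomial.aeval fun n => DiffeoGerm.coord (n + 1) φ

theorem map_germCharacter_genericSeries (φ : DiffeoGerm) :
    PowerSeries.map (germCharacter φ : HopfAlg →+* ℝ) genericSeries = φ.taylor := by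
  induction φ using Quotient.inductionOn with
  | _ a =>
    ext m
    change _ = PowerSeries.coeff m
      (PowerSeries.mk fun n => iteratedDeriv n a.toHomeo 0 / (n.factorial : ℝ))
    rw [PowerSeries.coeff_mk, PowerSeries.coeff_map]
    rcases m with _ | m
    · simp [coeff_zero_genericSeries, a.map_zero]
    · have hsm : ContDiffOn ℝ ∞ (deriv a.toHomeo) a.toHomeo.source :=
        a.smooth.deriv_of_isOpen a.toHomeo.open_source (by simp)
      -- On this neighbourhood of `0` the derivative is positive, hence the exponential of its
      -- logarithm.
      have hopen : IsOpen (a.toHomeo.source ∩ deriv a.toHomeo ⁻¹' Set.Ioi 0) :=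
        hsm.continuousOn.isOpen_inter_preimage a.toHomeo.open_source isOpen_Ioi
      have hu : ContDiffOn ℝ ∞ (fun t => Real.log (deriv a.toHomeo t))
          (a.toHomeo.source ∩ deriv a.toHomeo ⁻¹' Set.Ioi 0) :=
        (hsm.mono Set.inter_subset_left).log fun t ht => ne_of_gt ht.2
      have h := iteratedDeriv_exp_eq_bell hopen hu
        (fun t ht => (Real.exp_log ht.2).symm) m 0
        ⟨a.zero_mem, by simp [a.deriv_zero]⟩
      rw [a.deriv_zero, mul_one] at h
      rw [iteratedDeriv_succ', h, coeff_succ_genericSeries]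
      change germCharacter _ (_ • bell m) = _
      rw [map_smul, smul_eq_mul, div_eq_inv_mul]
      rfl

/-- A group-like element as a character. -/
def IsGroupLike.character {L : DualAlg} (h : IsGroupLike L) : HopfAlg →ₐ[ℝ] ℝ :=
  AlgHom.ofLinearMap L h.1 h.2

/-- For uniqueness the single function `f = x` suffices: `R A x` has as coefficients, up to
factorials, the values of `A` on the Bell polynomials. -/
theorem corresponds_iff (φ : DiffeoGerm) (A : DualAlg) :
    Corresponds functionAction A φ ↔ A = (germCharacter φ⁻¹).toLinearMap := by
  constructor
  · rintro ⟨hA, h⟩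
    have h1 := h PowerSeries.X
    have h0 : PowerSeries.constantCoeff (φ⁻¹).taylor = 0 := by
      rw [← map_germCharacter_genericSeries, ← PowerSeries.coeff_zero_eq_constantCoeff_apply,
        PowerSeries.coeff_map, coeff_zero_genericSeries, map_zero]
    have h0' : PowerSeries.constantCoeff
        (PowerSeries.map (hA.character : HopfAlg →+* ℝ) genericSeries) = 0 := by
      rw [← PowerSeries.coeff_zero_eq_constantCoeff_apply,
        PowerSeries.coeff_map, coeff_zero_genericSeries, map_zero]
    have hAc : A = hA.character.toLinearMap := rfl
    rw [hAc, functionAction_character, PowerSeries.subst_X (.of_constantCoeff_zero' h0'),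
      PowerSeries.subst_X (.of_constantCoeff_zero' h0), ← map_germCharacter_genericSeries] at h1
    rw [hAc]
    congr 1
    refine character_ext_bell fun n => ?_
    have h2 := congrArg (PowerSeries.coeff (n + 1)) h1
    rw [PowerSeries.coeff_map, PowerSeries.coeff_map, coeff_succ_genericSeries] at h2
    simp only [RingHom.coe_coe, map_smul, smul_eq_mul] at h2
    exact mul_left_cancel₀ (by positivity) h2
  · rintro rfl
    refine ⟨⟨by simp, by simp⟩, fun f => ?_⟩
    rw [functionAction_character, map_germCharacter_genericSeries]

theorem exists_functionAction :
    ∃ R : DualAlg →ₗ[ℝ] (PowerSeries ℝ →ₗ[ℝ] PowerSeries ℝ),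
      IsFunctionAction R ∧
      ∀ φ : DiffeoGerm, (∃! A, Corresponds R A φ) ∧
        ∀ A, Corresponds R A φ → ∀ n : ℕ,
          A (hopfDelta n) = DiffeoGerm.coord (n + 1) φ⁻¹ := by
  refine ⟨functionAction, isFunctionAction_functionAction, fun φ => ⟨?_, fun A hA n => ?_⟩⟩
  · exact ⟨_, (corresponds_iff φ _).mpr rfl, fun A hA => (corresponds_iff φ A).mp hA⟩
  · rw [(corresponds_iff φ A).mp hA]
    simp [germCharacter, hopfDelta]

/-! ## Affine coordinates on the line -/

/-- Two integrations: `σ = ∫ exp (∫ g)`. -/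
theorem exists_affine_function {g : ℝ → ℝ} (hg : ContDiff ℝ ∞ g) :
    ∃ σ : ℝ → ℝ, ContDiff ℝ ∞ σ ∧ (∀ r, deriv σ r ≠ 0) ∧
      ∀ r, deriv (deriv σ) r = g r * deriv σ r := by
  have prim : ∀ k : ℝ → ℝ, ContDiff ℝ ∞ k → ∃ K : ℝ → ℝ, ContDiff ℝ ∞ K ∧ deriv K = k := by
    intro k hk
    have hd : ∀ r, HasDerivAt (fun r => ∫ s in (0 : ℝ)..r, k s) (k r) r := fun r =>
      (hk.continuous.integral_hasStrictDerivAt 0 r).hasDerivAt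
    have hd' : deriv (fun r => ∫ s in (0 : ℝ)..r, k s) = k := funext fun r => (hd r).deriv
    refine ⟨_, contDiff_infty_iff_deriv.mpr ⟨fun r => (hd r).differentiableAt, ?_⟩, hd'⟩
    rwa [hd']
  obtain ⟨K, hK, hK'⟩ := prim g hg
  obtain ⟨σ, hσ, hσ'⟩ := prim (fun r => Real.exp (K r)) hK.exp
  refine ⟨σ, hσ, fun r => by rw [hσ']; exact (Real.exp_pos _).ne', fun r => ?_⟩
  have h := ((hK.differentiable (by simp)) r).hasDerivAt.exp.deriv
  rw [hσ', h, hK', mul_comm]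

theorem exists_openPartialHomeomorph {σ : ℝ → ℝ} (hσ : ContDiff ℝ ∞ σ) (hσ' : ∀ r, deriv σ r ≠ 0)
    (r₀ : ℝ) : ∃ H : OpenPartialHomeomorph ℝ ℝ, (H : ℝ → ℝ) = σ ∧ r₀ ∈ H.source ∧
      ContDiffOn ℝ ∞ H.symm H.target := by
  have hd : ∀ r, HasDerivAt σ (deriv σ r) r := fun r =>
    (hσ.differentiable (by simp) r).hasDerivAt
  have hs : HasStrictFDerivAt σ (((ContinuousLinearEquiv.unitsEquivAut ℝ)
      (Units.mk0 _ (hσ' r₀)) : ℝ ≃L[ℝ] ℝ) : ℝ →L[ℝ] ℝ) r₀ :=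
    hσ.contDiffAt.hasStrictDerivAt' (hd r₀) (by simp)
  refine ⟨hs.toOpenPartialHomeomorph σ, rfl, hs.mem_toOpenPartialHomeomorph_source, ?_⟩
  intro a ha
  exact (OpenPartialHomeomorph.contDiffAt_symm_deriv _ (hσ' _) ha (hd _)
    hσ.contDiffAt).contDiffWithinAt

/-- A smooth function near a point of the line extends, as a germ, to a smooth function. -/
theorem exists_contDiff_eventuallyEq {g : ℝ → ℝ} {s : Set ℝ} (hs : IsOpen s)
    (hg : ContDiffOn ℝ ∞ g s) {r₀ : ℝ} (h₀ : r₀ ∈ s) :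
    ∃ g' : ℝ → ℝ, ContDiff ℝ ∞ g' ∧ g' =ᶠ[𝓝 r₀] g := by
  obtain ⟨ρ, hρ⟩ : ∃ ρ : ContDiffBump r₀, tsupport ρ ⊆ s := by
    obtain ⟨ε, hε, hb⟩ := Metric.isOpen_iff.mp hs r₀ h₀
    refine ⟨⟨ε / 4, ε / 2, by positivity, by linarith⟩, ?_⟩
    rw [ContDiffBump.tsupport_eq]
    exact (Metric.closedBall_subset_ball (by linarith)).trans hb
  refine ⟨fun r => ρ r * g r, contDiff_iff_contDiffAt.mpr fun r => ?_, ?_⟩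
  · by_cases hr : r ∈ tsupport ρ
    · exact ρ.contDiffAt.mul (hg.contDiffAt (hs.mem_nhds (hρ hr)))
    · refine contDiffAt_const (c := (0 : ℝ)) |>.congr_of_eventuallyEq ?_
      filter_upwards [(isClosed_tsupport ρ).isOpen_compl.mem_nhds hr] with t ht
      rw [image_eq_zero_of_notMem_tsupport ht, zero_mul]
  · filter_upwards [ρ.eventuallyEq_one] with r hr
    simp [hr]

/-! ## Local diffeomorphisms -/

/-- A local homeomorphism which is smooth with smooth inverse. -/
def IsLocalDiffeo {M M' : Type*} [TopologicalSpace M] [ChartedSpace ℝ M] [TopologicalSpace M']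
    [ChartedSpace ℝ M'] (f : OpenPartialHomeomorph M M') : Prop :=
  ContMDiffOn 𝓘(ℝ, ℝ) 𝓘(ℝ, ℝ) ∞ f f.source ∧ ContMDiffOn 𝓘(ℝ, ℝ) 𝓘(ℝ, ℝ) ∞ f.symm f.target

namespace IsLocalDiffeo

variable {M M' M'' : Type*} [TopologicalSpace M] [ChartedSpace ℝ M] [TopologicalSpace M']
  [ChartedSpace ℝ M'] [TopologicalSpace M''] [ChartedSpace ℝ M'']
  {f : OpenPartialHomeomorph M M'} {f' : OpenPartialHomeomorph M' M''}

theorem symm (h : IsLocalDiffeo f) : IsLocalDiffeo f.symm := ⟨h.2, h.1⟩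

theorem trans (h : IsLocalDiffeo f) (h' : IsLocalDiffeo f') : IsLocalDiffeo (f.trans f') := by
  refine ⟨?_, ?_⟩
  · rw [OpenPartialHomeomorph.trans_source]
    exact h'.1.comp (h.1.mono Set.inter_subset_left) fun x hx => hx.2
  · rw [OpenPartialHomeomorph.trans_target]
    exact h.2.comp (h'.2.mono Set.inter_subset_left) fun x hx => hx.2

theorem restrOpen (h : IsLocalDiffeo f) {s : Set M} (hs : IsOpen s) :
    IsLocalDiffeo (f.restrOpen s hs) := by
  refine ⟨h.1.mono ?_, h.2.mono ?_⟩
  · exact Set.inter_subset_left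
  · exact Set.inter_subset_left

theorem contMDiffAt (h : IsLocalDiffeo f) {x : M} (hx : x ∈ f.source) :
    ContMDiffAt 𝓘(ℝ, ℝ) 𝓘(ℝ, ℝ) ∞ f x :=
  h.1.contMDiffAt (f.open_source.mem_nhds hx)

theorem mdifferentiableAt (h : IsLocalDiffeo f) {x : M} (hx : x ∈ f.source) :
    MDifferentiableAt 𝓘(ℝ, ℝ) 𝓘(ℝ, ℝ) f x :=
  (h.contMDiffAt hx).mdifferentiableAt (by simp)

end IsLocalDiffeo

theorem isLocalDiffeo_chartAt {M : Type*} [TopologicalSpace M] [ChartedSpace ℝ M]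
    [IsManifold 𝓘(ℝ, ℝ) ∞ M] (x : M) : IsLocalDiffeo (chartAt ℝ x) :=
  ⟨contMDiffOn_chart, contMDiffOn_chart_symm⟩

/-! ## The connection in a chart -/

section Connection

variable {M : Type*} [TopologicalSpace M] [ChartedSpace ℝ M] [IsManifold 𝓘(ℝ, ℝ) ∞ M]

theorem tangentCoordChange_apply_one {x y z : M} :
    tangentCoordChange 𝓘(ℝ, ℝ) x y z (1 : ℝ) =
      deriv (chartAt ℝ y ∘ (chartAt ℝ x).symm) (chartAt ℝ x z) := by
  rw [tangentCoordChange_def]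
  simp only [extChartAt, OpenPartialHomeomorph.extend, modelWithCornersSelf_partialEquiv,
    PartialEquiv.trans_refl, modelWithCornersSelf_coe, Set.range_id, fderivWithin_univ]
  exact fderiv_apply_one_eq_deriv

theorem coordField_eq_smul {x x₀ z : M} (hz : z ∈ (chartAt ℝ x).source)
    (hz₀ : z ∈ (chartAt ℝ x₀).source) :
    coordField x z =
      (deriv (chartAt ℝ x₀ ∘ (chartAt ℝ x).symm) (chartAt ℝ x z)) • coordField x₀ z := by
  have h := tangentCoordChange_comp (I := 𝓘(ℝ, ℝ)) (w := x) (x := x₀) (y := z) (z := z)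
    (v := (1 : ℝ)) (by simp [hz, hz₀])
  rw [coordField, ← h, tangentCoordChange_apply_one]
  have h1 := (tangentCoordChange 𝓘(ℝ, ℝ) x₀ z z).map_smul
    (deriv (chartAt ℝ x₀ ∘ (chartAt ℝ x).symm) (chartAt ℝ x z)) (1 : ℝ)
  rw [smul_eq_mul, mul_one] at h1
  exact h1

theorem mfderiv_chartAt_self (x : M) :
    mfderiv 𝓘(ℝ, ℝ) 𝓘(ℝ, ℝ) (chartAt ℝ x) x (1 : ℝ) = (1 : ℝ) := by
  have h := mfderiv_chartAt_eq_tangentCoordChange (I := 𝓘(ℝ, ℝ)) (mem_chart_source ℝ x)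
  have h1 := congrArg (fun L : ℝ →L[ℝ] ℝ => L 1) h
  exact h1.trans (tangentCoordChange_self (E := ℝ) (mem_extChartAt_source x))

theorem coordField_self (x : M) : coordField x x = (1 : ℝ) :=
  tangentCoordChange_self (E := ℝ) (mem_extChartAt_source x)

theorem trivializationAt_snd (x₀ z : M) (v : TangentSpace 𝓘(ℝ, ℝ) z) :
    (trivializationAt ℝ (TangentSpace 𝓘(ℝ, ℝ)) x₀ ⟨z, v⟩).2 =
      tangentCoordChange 𝓘(ℝ, ℝ) z x₀ z v := rfl

theorem contMDiffOn_coordField (x₀ : M) :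
    ContMDiffOn 𝓘(ℝ, ℝ) 𝓘(ℝ, ℝ).tangent ∞
      (fun z => (⟨z, coordField x₀ z⟩ : TangentBundle 𝓘(ℝ, ℝ) M)) (chartAt ℝ x₀).source := by
  have h := (trivializationAt ℝ (TangentSpace 𝓘(ℝ, ℝ)) x₀).contMDiffOn_section_baseSet_iff
    (IB := 𝓘(ℝ, ℝ)) (n := ∞) (s := fun z => coordField x₀ z)
  refine h.mpr ?_
  refine (contMDiffOn_const (c := (1 : ℝ))).congr fun z hz => ?_
  rw [trivializationAt_snd, coordField, tangentCoordChange_comp, tangentCoordChange_self]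
  · simpa using hz
  · have hz' : z ∈ (chartAt ℝ x₀).source := hz
    simp [hz']

/-- The smoothness of `D` is applied to a global section, the coordinate field cut off by a bump
function; the cut-off equals `1` near `x₀` and drops out there by locality of `D`. The coefficient
is extended to all of `ℝ` so that `exists_affine_function` applies. -/
theorem exists_connection_coefficient [T2Space M] (D : Connection M)
    [CovariantDerivative.ContMDiffCovariantDerivative D ∞] (x₀ : M) :
    ∃ g : ℝ → ℝ, ContDiff ℝ ∞ g ∧ ∀ᶠ z in 𝓝 x₀,
      D (coordField x₀) z (coordField x₀ z) = g (chartAt ℝ x₀ z) • coordField x₀ z := by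
  let χ : SmoothBumpFunction 𝓘(ℝ, ℝ) x₀ := Classical.arbitrary _
  have hV : ContMDiff 𝓘(ℝ, ℝ) 𝓘(ℝ, ℝ).tangent ∞ (fun z =>
      (⟨z, ((χ : M → ℝ) • coordField x₀) z⟩ : TangentBundle 𝓘(ℝ, ℝ) M)) :=
    ContMDiffOn.smul_section_of_tsupport χ.contMDiff.contMDiffOn (chartAt ℝ x₀).open_source
      χ.tsupport_subset_chartAt_source (contMDiffOn_coordField x₀)
  have hD := (CovariantDerivative.ContMDiffCovariantDerivative.contMDiff (cov := D)
    (k := ∞)).contMDiff (σ := (χ : M → ℝ) • coordField x₀) hV.contMDiffOn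
  rw [contMDiffOn_univ] at hD
  have hW := ContMDiff.clm_bundle_apply hD hV
  let W : (z : M) → TangentSpace 𝓘(ℝ, ℝ) z := fun z =>
    D ((χ : M → ℝ) • coordField x₀) z (((χ : M → ℝ) • coordField x₀) z)
  have hW' : ContMDiffOn 𝓘(ℝ, ℝ) 𝓘(ℝ, ℝ).tangent ∞
      (fun z => (⟨z, W z⟩ : TangentBundle 𝓘(ℝ, ℝ) M)) (chartAt ℝ x₀).source := hW.contMDiffOn
  have hG := ((trivializationAt ℝ (TangentSpace 𝓘(ℝ, ℝ)) x₀).contMDiffOn_section_baseSet_iff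
    (IB := 𝓘(ℝ, ℝ)) (n := ∞) (s := W)).mp hW'
  have hg : ContDiffOn ℝ ∞ ((fun z => (trivializationAt ℝ (TangentSpace 𝓘(ℝ, ℝ)) x₀ ⟨z, W z⟩).2) ∘
      (chartAt ℝ x₀).symm) (chartAt ℝ x₀).target :=
    (hG.comp contMDiffOn_chart_symm (chartAt ℝ x₀).mapsTo_symm).contDiffOn
  obtain ⟨g, hgs, hge⟩ := exists_contDiff_eventuallyEq (chartAt ℝ x₀).open_target hg
    (mem_chart_target ℝ x₀)
  refine ⟨g, hgs, ?_⟩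
  have h1 := ((chartAt ℝ x₀).continuousAt (mem_chart_source ℝ x₀)).tendsto.eventually hge
  filter_upwards [h1, (chartAt ℝ x₀).open_source.mem_nhds (mem_chart_source ℝ x₀),
    eventually_eventually_nhds.mpr χ.eventuallyEq_one] with z hz hzs hz1
  have hVz : ((χ : M → ℝ) • coordField x₀) z = coordField x₀ z := by
    simp [hz1.self_of_nhds]
  have hWz : W z = D (coordField x₀) z (coordField x₀ z) := by
    have h2 : D ((χ : M → ℝ) • coordField x₀) z = D (coordField x₀) z := by
      refine (D.isCovariantDerivativeOn (s := Set.univ)).congr_of_eventuallyEq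
        ((hV z).mdifferentiableAt (by simp))
        (((contMDiffOn_coordField x₀).contMDiffAt
          ((chartAt ℝ x₀).open_source.mem_nhds hzs)).mdifferentiableAt (by simp))
        Filter.univ_mem ?_
      filter_upwards [hz1] with w hw
      simp [hw]
    change D ((χ : M → ℝ) • coordField x₀) z _ = _
    rw [h2, hVz]
  rw [← hWz, hz, Function.comp_apply, (chartAt ℝ x₀).left_inv hzs, trivializationAt_snd]
  have h3 : ∀ w : ℝ,
      tangentCoordChange 𝓘(ℝ, ℝ) x₀ z z (tangentCoordChange 𝓘(ℝ, ℝ) z x₀ z w) = w := by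
    intro w
    rw [tangentCoordChange_comp, tangentCoordChange_self]
    · simp
    · simp [hzs]
  have h4 := (tangentCoordChange 𝓘(ℝ, ℝ) x₀ z z).map_smul
    (tangentCoordChange 𝓘(ℝ, ℝ) z x₀ z (W z)) (1 : ℝ)
  rw [smul_eq_mul, mul_one] at h4
  exact (h3 (W z)).symm.trans h4

/-- The transformation law of the Christoffel symbol. -/
theorem christoffel_mul_deriv (D : Connection M) {x x₀ : M} (hx : x ∈ (chartAt ℝ x₀).source)
    {c : ℝ} (hc : D (coordField x₀) x (coordField x₀ x) = c • coordField x₀ x) :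
    let τ := chartAt ℝ x₀ ∘ (chartAt ℝ x).symm
    christoffel D x * deriv τ (chartAt ℝ x x) =
      c * deriv τ (chartAt ℝ x x) ^ 2 + deriv (deriv τ) (chartAt ℝ x x) := by
  intro τ
  have hτ : ContDiffAt ℝ ∞ τ (chartAt ℝ x x) := by
    have h := (((isLocalDiffeo_chartAt x).symm.trans (isLocalDiffeo_chartAt x₀)).contMDiffAt
      (x := chartAt ℝ x x) (by simp [hx])).contDiffAt
    exact h
  have hxx := mem_chart_source ℝ x
  have hm : MDifferentiableAt 𝓘(ℝ, ℝ) 𝓘(ℝ, ℝ) (fun z => deriv τ (chartAt ℝ x z)) x := by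
    have h := (contDiffAt_deriv hτ).contMDiffAt.comp x ((isLocalDiffeo_chartAt x).contMDiffAt hxx)
    exact h.mdifferentiableAt (by simp)
  have hS : MDifferentiableAt 𝓘(ℝ, ℝ) 𝓘(ℝ, ℝ).tangent
      (fun z => (⟨z, coordField x₀ z⟩ : TangentBundle 𝓘(ℝ, ℝ) M)) x :=
    ((contMDiffOn_coordField x₀).contMDiffAt
      ((chartAt ℝ x₀).open_source.mem_nhds hx)).mdifferentiableAt (by simp)
  have hS' : MDifferentiableAt 𝓘(ℝ, ℝ) 𝓘(ℝ, ℝ).tangent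
      (fun z => (⟨z, coordField x z⟩ : TangentBundle 𝓘(ℝ, ℝ) M)) x :=
    ((contMDiffOn_coordField x).contMDiffAt
      ((chartAt ℝ x).open_source.mem_nhds hxx)).mdifferentiableAt (by simp)
  -- The coordinate fields differ by the factor `τ'`; the Leibniz rule for this product produces the
  -- inhomogeneous term `τ''`.
  have hev : ∀ᶠ z in 𝓝 x, coordField x z =
      ((fun z => deriv τ (chartAt ℝ x z)) • coordField x₀) z := by
    filter_upwards [(chartAt ℝ x).open_source.mem_nhds hxx,
      (chartAt ℝ x₀).open_source.mem_nhds hx] with z hz hz₀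
    exact coordField_eq_smul hz hz₀
  have hS'' : MDifferentiableAt 𝓘(ℝ, ℝ) 𝓘(ℝ, ℝ).tangent (fun z => (⟨z,
      ((fun z => deriv τ (chartAt ℝ x z)) • coordField x₀) z⟩ : TangentBundle 𝓘(ℝ, ℝ) M)) x := by
    refine hS'.congr_of_eventuallyEq ?_
    filter_upwards [hev] with z hz
    rw [hz]
  have h1 := (D.isCovariantDerivativeOn (s := Set.univ)).congr_of_eventuallyEq hS' hS''
    Filter.univ_mem hev
  rw [(D.isCovariantDerivativeOn (s := Set.univ)).leibniz hS hm] at h1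
  have h2 : mfderiv 𝓘(ℝ, ℝ) 𝓘(ℝ, ℝ) (fun z => deriv τ (chartAt ℝ x z)) x (1 : ℝ) =
      deriv (deriv τ) (chartAt ℝ x x) := by
    have hd : DifferentiableAt ℝ (deriv τ) (chartAt ℝ x x) :=
      (contDiffAt_deriv hτ).differentiableAt (by simp)
    have h := mfderiv_comp_apply x hd.mdifferentiableAt
      ((isLocalDiffeo_chartAt x).mdifferentiableAt hxx) (1 : ℝ)
    refine h.trans ?_
    rw [mfderiv_chartAt_self, mfderiv_eq_fderiv]
    have h' : fderiv ℝ (deriv τ) (chartAt ℝ x x) 1 = deriv (deriv τ) (chartAt ℝ x x) :=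
      fderiv_apply_one_eq_deriv
    exact h'
  have ha := (coordField_eq_smul hxx hx).symm.trans (coordField_self x)
  set a : ℝ := coordField x₀ x with ha_def
  set m : ℝ := deriv τ (chartAt ℝ x x) with hm_def
  have ha' : m * a = 1 := ha
  have h3 : D (coordField x₀) x (1 : ℝ) = m * (c * a) := by
    rw [← ha']
    have h4 := (D (coordField x₀) x).map_smul m (coordField x₀ x)
    rw [hc] at h4
    exact h4
  have h5 : christoffel D x = m * (m * (c * a)) + deriv (deriv τ) (chartAt ℝ x x) * a := by
    rw [← h3, ← h2]
    exact congrArg (fun L : ℝ →L[ℝ] ℝ => L 1) h1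
  rw [h5]
  linear_combination (c * m ^ 2 + deriv (deriv τ) (chartAt ℝ x x)) * ha'

end Connection

section Affine

variable {M : Type*} [TopologicalSpace M] [ChartedSpace ℝ M] [IsManifold 𝓘(ℝ, ℝ) ∞ M]

/-! ## Affine charts -/

/-- The coordinate of a tangent vector in a chart. -/
def velocity (e : OpenPartialHomeomorph M ℝ) (p : TangentBundle 𝓘(ℝ, ℝ) M) : ℝ :=
  mfderiv 𝓘(ℝ, ℝ) 𝓘(ℝ, ℝ) e p.1 p.2

/-- The coordinates of the tangent bundle induced by a chart. -/
def frameMap (e : OpenPartialHomeomorph M ℝ) (p : TangentBundle 𝓘(ℝ, ℝ) M) : ℝ × ℝ :=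
  (e p.1, velocity e p)

/-- The derivative of `(r, y) ↦ (k r, k' r * y)`. -/
theorem hasFDerivAt_prolongation {k : ℝ → ℝ} {r y : ℝ} (hk : ContDiffAt ℝ ∞ k r) :
    HasFDerivAt (fun z : ℝ × ℝ => (k z.1, deriv k z.1 * z.2))
      ((deriv k r • ContinuousLinearMap.fst ℝ ℝ ℝ).prod
        (deriv k r • ContinuousLinearMap.snd ℝ ℝ ℝ +
          y • deriv (deriv k) r • ContinuousLinearMap.fst ℝ ℝ ℝ)) (r, y) := by
  have h1 : HasDerivAt k (deriv k r) (r, y).1 := (hk.differentiableAt (by simp)).hasDerivAt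
  have h2 : HasDerivAt (deriv k) (deriv (deriv k) r) (r, y).1 :=
    ((contDiffAt_deriv hk).differentiableAt (by simp)).hasDerivAt
  have hf : HasFDerivAt (fun z : ℝ × ℝ => z.1) (ContinuousLinearMap.fst ℝ ℝ ℝ) (r, y) :=
    hasFDerivAt_fst
  have hs : HasFDerivAt (fun z : ℝ × ℝ => z.2) (ContinuousLinearMap.snd ℝ ℝ ℝ) (r, y) :=
    hasFDerivAt_snd
  exact (h1.comp_hasFDerivAt (r, y) hf).prodMk ((h2.comp_hasFDerivAt (r, y) hf).mul hs)

theorem velocity_eq_mul {e : OpenPartialHomeomorph M ℝ} (he : IsLocalDiffeo e) {x : M}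
    {q : TangentBundle 𝓘(ℝ, ℝ) M} (hq : q.1 ∈ e.source) (hqx : q.1 ∈ (chartAt ℝ x).source) :
    velocity e q = deriv (e ∘ (chartAt ℝ x).symm) (chartAt ℝ x q.1) *
      velocity (chartAt ℝ x) q := by
  have hk : ContDiffAt ℝ ∞ (e ∘ (chartAt ℝ x).symm) (chartAt ℝ x q.1) :=
    ((((isLocalDiffeo_chartAt x).symm.trans he).contMDiffAt
      (x := chartAt ℝ x q.1) (by simp [hqx, hq]))).contDiffAt
  have hev : (e : M → ℝ) =ᶠ[𝓝 q.1] (e ∘ (chartAt ℝ x).symm) ∘ chartAt ℝ x := by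
    filter_upwards [(chartAt ℝ x).open_source.mem_nhds hqx] with z hz
    simp [(chartAt ℝ x).left_inv hz]
  have h := mfderiv_comp_apply q.1 (hk.differentiableAt (by simp)).mdifferentiableAt
      ((isLocalDiffeo_chartAt x).mdifferentiableAt hqx) q.2
  rw [velocity, hev.mfderiv_eq]
  refine h.trans ?_
  rw [mfderiv_eq_fderiv]
  have h' : ∀ v : ℝ, fderiv ℝ (e ∘ (chartAt ℝ x).symm) (chartAt ℝ x q.1) v =
      deriv (e ∘ (chartAt ℝ x).symm) (chartAt ℝ x q.1) * v := by
    intro v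
    rw [fderiv_eq_smul_deriv, smul_eq_mul, mul_comm]
  exact h' _

theorem velocity_chartAt_self (p : TangentBundle 𝓘(ℝ, ℝ) M) :
    velocity (chartAt ℝ p.1) p = frameCoord p := by
  have h := mfderiv_chartAt_eq_tangentCoordChange (I := 𝓘(ℝ, ℝ)) (mem_chart_source ℝ p.1)
  have h1 := congrArg (fun L : ℝ →L[ℝ] ℝ => L p.2) h
  exact h1.trans (tangentCoordChange_self (E := ℝ) (mem_extChartAt_source p.1))

theorem extChartAt_tangent_apply {p q : TangentBundle 𝓘(ℝ, ℝ) M}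
    (h : q.1 ∈ (chartAt ℝ p.1).source) :
    extChartAt 𝓘(ℝ, ℝ).tangent p q = (chartAt ℝ p.1 q.1, velocity (chartAt ℝ p.1) q) := by
  have h1 := congrArg (fun z : TangentBundle 𝓘(ℝ, ℝ) ℝ => ((z.1, z.2) : ℝ × ℝ))
    (tangentMap_chart (I := 𝓘(ℝ, ℝ)) h)
  exact h1.symm

theorem eventually_fst_mem {p : TangentBundle 𝓘(ℝ, ℝ) M} {s : Set M} (hs : s ∈ 𝓝 p.1) :
    ∀ᶠ q : TangentBundle 𝓘(ℝ, ℝ) M in 𝓝 p, q.1 ∈ s :=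
  (FiberBundle.continuous_proj ℝ (TangentSpace 𝓘(ℝ, ℝ) : M → Type _)).continuousAt.tendsto.eventually
    hs

/-- The derivative of the induced coordinates in the preferred chart of a point. -/
theorem mfderiv_frameMap {e : OpenPartialHomeomorph M ℝ} (he : IsLocalDiffeo e)
    {p : TangentBundle 𝓘(ℝ, ℝ) M} (hp : p.1 ∈ e.source) (v : ℝ × ℝ) :
    let k := e ∘ (chartAt ℝ p.1).symm
    let r := chartAt ℝ p.1 p.1
    MDifferentiableAt 𝓘(ℝ, ℝ).tangent 𝓘(ℝ, ℝ × ℝ) (frameMap e) p ∧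
    mfderiv 𝓘(ℝ, ℝ).tangent 𝓘(ℝ, ℝ × ℝ) (frameMap e) p v =
      ((deriv k r * v.1, deriv k r * v.2 + frameCoord p * (deriv (deriv k) r * v.1)) : ℝ × ℝ) := by
  intro k r
  have hk : ContDiffAt ℝ ∞ k r :=
    ((((isLocalDiffeo_chartAt p.1).symm.trans he).contMDiffAt
      (x := chartAt ℝ p.1 p.1) (by simp [hp]))).contDiffAt
  have hpp : extChartAt 𝓘(ℝ, ℝ).tangent p p = (r, frameCoord p) := by
    rw [extChartAt_tangent_apply (mem_chart_source ℝ p.1), velocity_chartAt_self]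
  have hev : frameMap e =ᶠ[𝓝 p]
      (fun z : ℝ × ℝ => (k z.1, deriv k z.1 * z.2)) ∘ extChartAt 𝓘(ℝ, ℝ).tangent p := by
    filter_upwards [eventually_fst_mem (e.open_source.mem_nhds hp),
      eventually_fst_mem ((chartAt ℝ p.1).open_source.mem_nhds (mem_chart_source ℝ p.1))]
      with q hq hq'
    rw [Function.comp_apply, extChartAt_tangent_apply hq', frameMap, velocity_eq_mul he hq hq']
    simp only [k, Function.comp_apply, (chartAt ℝ p.1).left_inv hq']
  have hK := hasFDerivAt_prolongation (y := frameCoord p) hk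
  rw [← hpp] at hK
  -- Tangent vectors at `p` are written in the preferred chart at `p`, whose derivative at `p` is
  -- therefore the identity.
  have hext : HasMFDerivAt 𝓘(ℝ, ℝ).tangent 𝓘(ℝ, ℝ × ℝ) (extChartAt 𝓘(ℝ, ℝ).tangent p) p
      (ContinuousLinearMap.id ℝ (ℝ × ℝ)) := by
    have h := (mdifferentiableAt_extChartAt (I := 𝓘(ℝ, ℝ).tangent)
      (mem_chart_source (ModelProd ℝ ℝ) p)).hasMFDerivAt
    rw [mfderiv_extChartAt_self] at h
    exact h
  have h := (HasMFDerivAt.comp p hK.hasMFDerivAt hext).congr_of_eventuallyEq hev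
  refine ⟨h.mdifferentiableAt, ?_⟩
  rw [h.mfderiv]
  rfl

/-- A chart is affine when the connection is trivial in this chart. -/
structure IsAffineChart (D : Connection M) (e : OpenPartialHomeomorph M ℝ) : Prop where
  diffeo : IsLocalDiffeo e
  horizontal_eq : ∀ p : TangentBundle 𝓘(ℝ, ℝ) M, p.1 ∈ e.source →
    mfderiv 𝓘(ℝ, ℝ).tangent 𝓘(ℝ, ℝ × ℝ) (frameMap e) p (horizontal D p) =
      ((velocity e p, 0) : ℝ × ℝ)
  connForm_eq : ∀ (p : TangentBundle 𝓘(ℝ, ℝ) M) (v : TangentSpace 𝓘(ℝ, ℝ).tangent p),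
    p.1 ∈ e.source → connForm D p v = ((mfderiv 𝓘(ℝ, ℝ).tangent 𝓘(ℝ, ℝ × ℝ) (frameMap e) p v :
      ℝ × ℝ)).2 / velocity e p

theorem IsLocalDiffeo.deriv_ne_zero {f : OpenPartialHomeomorph ℝ ℝ} (hf : IsLocalDiffeo f) {r : ℝ}
    (hr : r ∈ f.source) : deriv f r ≠ 0 := by
  have h1 := ((hf.contMDiffAt hr).contDiffAt.differentiableAt (by simp)).hasDerivAt
  have h2 := ((hf.symm.contMDiffAt (f.map_source hr)).contDiffAt.differentiableAt
    (by simp)).hasDerivAt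
  have h3 := h2.comp r h1
  have h4 : f.symm ∘ f =ᶠ[𝓝 r] id := by
    filter_upwards [f.open_source.mem_nhds hr] with t ht using f.left_inv ht
  have h5 := (h3.congr_of_eventuallyEq h4.symm).unique (hasDerivAt_id r)
  intro h0
  rw [h0, mul_zero] at h5
  exact zero_ne_one h5

/-- With `k` the chart read in the preferred chart at `x`, the image of `y (∂ - Γ y ∂_y)` has fibre
component `y² (k'' - Γ k')`, which the hypothesis makes zero. -/
theorem isAffineChart_of_christoffel {D : Connection M} {e : OpenPartialHomeomorph M ℝ}
    (he : IsLocalDiffeo e)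
    (h : ∀ x ∈ e.source, deriv (deriv (e ∘ (chartAt ℝ x).symm)) (chartAt ℝ x x) =
      christoffel D x * deriv (e ∘ (chartAt ℝ x).symm) (chartAt ℝ x x)) :
    IsAffineChart D e where
  diffeo := he
  horizontal_eq p hp := by
    refine (mfderiv_frameMap he hp _).2.trans ?_
    rw [velocity_eq_mul he hp (mem_chart_source ℝ p.1), velocity_chartAt_self, h p.1 hp]
    refine Prod.ext rfl ?_
    simp only [horizontal]
    ring
  connForm_eq p v hp := by
    have h1 := congrArg Prod.snd (mfderiv_frameMap he hp v).2
    refine Eq.trans ?_ (congrArg (· / velocity e p) h1.symm)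
    have hne : deriv (e ∘ (chartAt ℝ p.1).symm) (chartAt ℝ p.1 p.1) ≠ 0 :=
      ((isLocalDiffeo_chartAt p.1).symm.trans he).deriv_ne_zero
        (r := chartAt ℝ p.1 p.1) (by simp [hp])
    rw [velocity_eq_mul he hp (mem_chart_source ℝ p.1), velocity_chartAt_self, h p.1 hp]
    simp only [connForm]
    rw [← mul_div_mul_left _ _ hne]
    congr 1
    ring

/-- The chart is `H` after the preferred chart at `x₀`, with `H'' = g H'`. For the chart change `τ`
from a point `x`, `(H ∘ τ)'' = H' (g τ'² + τ'') = Γ (H ∘ τ)'` by `christoffel_mul_deriv`. -/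
theorem exists_isAffineChart [T2Space M] (D : Connection M)
    [CovariantDerivative.ContMDiffCovariantDerivative D ∞] (x₀ : M) :
    ∃ e : OpenPartialHomeomorph M ℝ, x₀ ∈ e.source ∧ IsAffineChart D e := by
  obtain ⟨g, hg, hgD⟩ := exists_connection_coefficient D x₀
  obtain ⟨σ, hσ, hσ', hσ''⟩ := exists_affine_function hg
  obtain ⟨H, rfl, h₀, hH⟩ := exists_openPartialHomeomorph hσ hσ' (chartAt ℝ x₀ x₀)
  obtain ⟨s, hs, hso, hs₀⟩ := eventually_nhds_iff.mp hgD
  have hHd : IsLocalDiffeo H := ⟨hσ.contDiffOn.contMDiffOn, hH.contMDiffOn⟩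
  have he : IsLocalDiffeo (((chartAt ℝ x₀).restrOpen s hso).trans H) :=
    ((isLocalDiffeo_chartAt x₀).restrOpen hso).trans hHd
  refine ⟨_, by simp [h₀, hs₀], isAffineChart_of_christoffel he fun x hx => ?_⟩
  have hx₀ : x ∈ (chartAt ℝ x₀).source := by
    simp at hx
    exact hx.1.1
  have hxs : x ∈ s := by
    simp at hx
    exact hx.1.2
  have hc := christoffel_mul_deriv D hx₀ (hs x hxs)
  set τ := chartAt ℝ x₀ ∘ (chartAt ℝ x).symm with hτ_def
  set r := chartAt ℝ x x with hr_def
  have hτr : τ r = chartAt ℝ x₀ x := by simp [hτ_def, hr_def]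
  have hτs : ContDiffAt ℝ ∞ τ r :=
    (((isLocalDiffeo_chartAt x).symm.trans (isLocalDiffeo_chartAt x₀)).contMDiffAt
      (x := chartAt ℝ x x) (by simp [hx₀])).contDiffAt
  have hk : (((chartAt ℝ x₀).restrOpen s hso).trans H : M → ℝ) ∘ (chartAt ℝ x).symm = H ∘ τ := rfl
  rw [hk]
  have hHdiff : ∀ t, HasDerivAt H (deriv H t) t := fun t =>
    (hσ.differentiable (by simp) t).hasDerivAt
  have h1 : deriv (H ∘ τ) =ᶠ[𝓝 r] fun t => (deriv H ∘ τ) t * deriv τ t := by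
    have hn : ∀ᶠ t in 𝓝 r, DifferentiableAt ℝ τ t :=
      ((hτs.of_le (m := 1) (by simp)).eventually (by simp)).mono
        fun t ht => ht.differentiableAt (by simp)
    filter_upwards [hn] with t ht
    exact ((hHdiff (τ t)).comp t ht.hasDerivAt).deriv
  have hH2 : HasDerivAt (deriv H) (g (τ r) * deriv H (τ r)) (τ r) := by
    rw [← hσ'']
    exact ((contDiffAt_deriv hσ.contDiffAt).differentiableAt (by simp)).hasDerivAt
  have hτ1 : HasDerivAt τ (deriv τ r) r := (hτs.differentiableAt (by simp)).hasDerivAt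
  have hτ2 : HasDerivAt (deriv τ) (deriv (deriv τ) r) r :=
    ((contDiffAt_deriv hτs).differentiableAt (by simp)).hasDerivAt
  rw [h1.deriv_eq, ((hH2.comp r hτ1).fun_mul hτ2).deriv, h1.self_of_nhds]
  rw [← hτr] at hc
  simp only [Function.comp_apply]
  linear_combination (-deriv H (τ r)) * hc

end Affine

section Affine

variable {M : Type*} [TopologicalSpace M] [ChartedSpace ℝ M] [IsManifold 𝓘(ℝ, ℝ) ∞ M]

/-! ## The inverse of the induced coordinates -/

/-- The inverse of the induced coordinates of the tangent bundle. -/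
def frameMapSymm (e : OpenPartialHomeomorph M ℝ) (z : ℝ × ℝ) : TangentBundle 𝓘(ℝ, ℝ) M :=
  tangentMap 𝓘(ℝ, ℝ) 𝓘(ℝ, ℝ) e.symm ⟨z.1, z.2⟩

theorem IsLocalDiffeo.mdifferentiable {N N' : Type*} [TopologicalSpace N] [ChartedSpace ℝ N]
    [TopologicalSpace N'] [ChartedSpace ℝ N'] {f : OpenPartialHomeomorph N N'} (hf : IsLocalDiffeo f) :
    f.MDifferentiable 𝓘(ℝ, ℝ) 𝓘(ℝ, ℝ) :=
  ⟨hf.1.mdifferentiableOn (by simp), hf.2.mdifferentiableOn (by simp)⟩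

theorem IsLocalDiffeo.contMDiffAt_tangentMap {N N' : Type*} [TopologicalSpace N] [ChartedSpace ℝ N]
    [IsManifold 𝓘(ℝ, ℝ) ∞ N] [TopologicalSpace N'] [ChartedSpace ℝ N'] [IsManifold 𝓘(ℝ, ℝ) ∞ N']
    {f : OpenPartialHomeomorph N N'} (hf : IsLocalDiffeo f) {p : TangentBundle 𝓘(ℝ, ℝ) N}
    (hp : p.1 ∈ f.source) :
    ContMDiffAt 𝓘(ℝ, ℝ).tangent 𝓘(ℝ, ℝ).tangent ∞ (tangentMap 𝓘(ℝ, ℝ) 𝓘(ℝ, ℝ) f) p := by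
  have h := hf.1.contMDiffOn_tangentMapWithin (m := ∞) (by simp) f.open_source.uniqueMDiffOn
  have hopen : IsOpen ((Bundle.TotalSpace.proj : TangentBundle 𝓘(ℝ, ℝ) N → N) ⁻¹' f.source) :=
    f.open_source.preimage (FiberBundle.continuous_proj ℝ (TangentSpace 𝓘(ℝ, ℝ) : N → Type _))
  refine (h.contMDiffAt (hopen.mem_nhds hp)).congr_of_eventuallyEq ?_
  filter_upwards [hopen.mem_nhds hp] with q hq
  exact (tangentMapWithin_eq_tangentMap (f.open_source.uniqueMDiffOn _ hq)
    (hf.mdifferentiableAt hq)).symm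

theorem contMDiff_frame_model :
    ContMDiff 𝓘(ℝ, ℝ × ℝ) 𝓘(ℝ, ℝ).tangent ∞
      (fun z : ℝ × ℝ => (⟨z.1, z.2⟩ : TangentBundle 𝓘(ℝ, ℝ) ℝ)) := by
  intro z
  rw [Bundle.contMDiffAt_totalSpace]
  refine ⟨contDiff_fst.contMDiff z, ?_⟩
  simp only [trivializationAt_model_space_apply]
  exact contDiff_snd.contMDiff z

variable {e : OpenPartialHomeomorph M ℝ}

theorem contMDiffAt_frameMapSymm (he : IsLocalDiffeo e) {z : ℝ × ℝ} (hz : z.1 ∈ e.target) :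
    ContMDiffAt 𝓘(ℝ, ℝ × ℝ) 𝓘(ℝ, ℝ).tangent ∞ (frameMapSymm e) z :=
  (he.symm.contMDiffAt_tangentMap (p := ⟨z.1, z.2⟩) hz).comp z (contMDiff_frame_model z)

omit [IsManifold 𝓘(ℝ, ℝ) ∞ M] in
theorem frameMapSymm_frameMap (he : IsLocalDiffeo e) {p : TangentBundle 𝓘(ℝ, ℝ) M}
    (hp : p.1 ∈ e.source) : frameMapSymm e (frameMap e p) = p := by
  obtain ⟨x, v⟩ := p
  have h := he.mdifferentiable.symm_comp_deriv hp
  have h1 := congrArg (fun L : ℝ →L[ℝ] ℝ => L v) h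
  -- All fibres are the same type `ℝ`, so equality in the total space splits into two plain
  -- equalities without transport.
  have h2 : ∀ (x' : M) (v' : ℝ), x' = x → v' = v →
      (⟨x', v'⟩ : TangentBundle 𝓘(ℝ, ℝ) M) = ⟨x, v⟩ := by
    rintro x' v' rfl rfl
    rfl
  exact h2 _ _ (e.left_inv hp) h1

omit [IsManifold 𝓘(ℝ, ℝ) ∞ M] in
theorem frameMap_frameMapSymm (he : IsLocalDiffeo e) {z : ℝ × ℝ} (hz : z.1 ∈ e.target) :
    frameMap e (frameMapSymm e z) = z := by
  obtain ⟨s, y⟩ := z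
  have h := he.mdifferentiable.comp_symm_deriv hz
  have h1 := congrArg (fun L : ℝ →L[ℝ] ℝ => L y) h
  exact Prod.ext (e.right_inv hz) h1

theorem mdifferentiableAt_frameMap (he : IsLocalDiffeo e) {p : TangentBundle 𝓘(ℝ, ℝ) M}
    (hp : p.1 ∈ e.source) :
    MDifferentiableAt 𝓘(ℝ, ℝ).tangent 𝓘(ℝ, ℝ × ℝ) (frameMap e) p :=
  (mfderiv_frameMap he hp 0).1

variable {D : Connection M}

/-- Obtained by differentiating `frameMapSymm ∘ frameMap = id`; it shows that lifts of straight
lines are integral curves. -/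
theorem mfderiv_frameMapSymm (he : IsAffineChart D e) {p : TangentBundle 𝓘(ℝ, ℝ) M}
    (hp : p.1 ∈ e.source) :
    mfderiv 𝓘(ℝ, ℝ × ℝ) 𝓘(ℝ, ℝ).tangent (frameMapSymm e) (frameMap e p)
      ((velocity e p, 0) : ℝ × ℝ) = horizontal D p := by
  have h1 := (mdifferentiableAt_frameMap he.diffeo hp).hasMFDerivAt
  have h2 := ((contMDiffAt_frameMapSymm he.diffeo (z := frameMap e p)
    (e.map_source hp)).mdifferentiableAt (by simp)).hasMFDerivAt
  have hid : (id : TangentBundle 𝓘(ℝ, ℝ) M → _) =ᶠ[𝓝 p] frameMapSymm e ∘ frameMap e := by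
    filter_upwards [eventually_fst_mem (e.open_source.mem_nhds hp)] with q hq
    exact (frameMapSymm_frameMap he.diffeo hq).symm
  have h3 := hasMFDerivAt_unique ((h2.comp p h1).congr_of_eventuallyEq hid) (hasMFDerivAt_id p)
  have h4 := congrArg (fun L : ℝ × ℝ →L[ℝ] ℝ × ℝ => L (horizontal D p)) h3
  have h5 : mfderiv 𝓘(ℝ, ℝ × ℝ) 𝓘(ℝ, ℝ).tangent (frameMapSymm e) (frameMap e p)
      (mfderiv 𝓘(ℝ, ℝ).tangent 𝓘(ℝ, ℝ × ℝ) (frameMap e) p (horizontal D p)) = horizontal D p := h4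
  rw [he.horizontal_eq p hp] at h5
  exact h5

/-! ## The exponential map -/

theorem eventually_eq_of_hasDerivAt_zero {f : ℝ → ℝ} (h : ∀ᶠ t in 𝓝 (0 : ℝ), HasDerivAt f 0 t) :
    ∀ᶠ t in 𝓝 (0 : ℝ), f t = f 0 := by
  obtain ⟨ε, hε, hb⟩ := Metric.eventually_nhds_iff_ball.mp h
  filter_upwards [Metric.ball_mem_nhds 0 hε] with t ht
  refine Metric.isOpen_ball.is_const_of_deriv_eq_zero (convex_ball (0 : ℝ) ε).isPreconnected
    (fun r hr => (hb r hr).differentiableAt.differentiableWithinAt) (fun r hr => (hb r hr).deriv)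
    ht (Metric.mem_ball_self hε)

/-- The geodesics in an affine chart. -/
theorem isExpCurve_iff (he : IsAffineChart D e) {α : TangentBundle 𝓘(ℝ, ℝ) M}
    (hα : α.1 ∈ e.source) (c : ℝ → M) :
    IsExpCurve D α c ↔ c =ᶠ[𝓝 0] fun t => e.symm (e α.1 + t * velocity e α) := by
  constructor
  · rintro ⟨b, hb0, hb, hc⟩
    have hcont : ContinuousAt b 0 := hb.self_of_nhds.continuousAt
    have hsrc : ∀ᶠ t in 𝓝 (0 : ℝ), (b t).1 ∈ e.source := by
      have h := eventually_fst_mem (p := b 0) (e.open_source.mem_nhds (by rw [hb0]; exact hα))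
      exact hcont.tendsto.eventually h
    have hder : ∀ᶠ t in 𝓝 (0 : ℝ),
        HasDerivAt (fun t => frameMap e (b t)) ((velocity e (b t), 0) : ℝ × ℝ) t := by
      filter_upwards [hb, hsrc] with t ht hts
      have h1 : ∀ (w : ℝ → ℝ × ℝ) (L : ℝ × ℝ →L[ℝ] ℝ × ℝ) (v v' : ℝ × ℝ),
          HasFDerivAt w (L.comp ((1 : ℝ →L[ℝ] ℝ).smulRight v)) t → L v = v' →
            HasDerivAt w v' t := by
        intro w L v v' hw hv
        refine hw.hasDerivAt.congr_deriv ?_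
        simpa using hv
      exact h1 _ _ _ _
        ((mdifferentiableAt_frameMap he.diffeo hts).hasMFDerivAt.comp t ht).hasFDerivAt
        (he.horizontal_eq (b t) hts)
    -- Along an integral curve of `y ∂_s` the fibre coordinate is constant, hence the base
    -- coordinate has constant speed.
    have hv := eventually_eq_of_hasDerivAt_zero (f := fun t => velocity e (b t))
      (hder.mono fun t ht => (ContinuousLinearMap.snd ℝ ℝ ℝ).hasFDerivAt.comp_hasDerivAt t ht)
    have hu := eventually_eq_of_hasDerivAt_zero
      (f := fun t => e (b t).1 - t * velocity e α) (by
        filter_upwards [hder, hv] with t ht hvt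
        have h1 : HasDerivAt (fun t => e (b t).1) (velocity e (b t)) t :=
          (ContinuousLinearMap.fst ℝ ℝ ℝ).hasFDerivAt.comp_hasDerivAt t ht
        refine (h1.sub ((hasDerivAt_id t).mul_const (velocity e α))).congr_deriv ?_
        rw [hvt, hb0]
        simp)
    filter_upwards [hc, hu, hsrc] with t hct hut hst
    rw [hb0] at hut
    rw [hct, ← e.left_inv hst]
    congr 1
    linarith
  · intro hc
    let b : ℝ → TangentBundle 𝓘(ℝ, ℝ) M := fun t =>
      frameMapSymm e (e α.1 + t * velocity e α, velocity e α)
    refine ⟨b, ?_, ?_, hc⟩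
    · simp only [b, zero_mul, add_zero]
      exact frameMapSymm_frameMap he.diffeo hα
    · have hl : ∀ t : ℝ, HasDerivAt (fun t : ℝ => (e α.1 + t * velocity e α, velocity e α))
          ((velocity e α, 0) : ℝ × ℝ) t := by
        intro t
        have h1 := ((hasDerivAt_id t).mul_const (velocity e α)).const_add (e α.1)
        rw [one_mul] at h1
        exact h1.prodMk (hasDerivAt_const t _)
      have htar : ∀ᶠ t in 𝓝 (0 : ℝ), e α.1 + t * velocity e α ∈ e.target := by
        have hcont : ContinuousAt (fun t : ℝ => e α.1 + t * velocity e α) 0 := by fun_prop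
        refine hcont.tendsto.eventually (e.open_target.mem_nhds ?_)
        simpa using e.map_source hα
      change ∀ᶠ t in 𝓝 (0 : ℝ), _
      filter_upwards [htar] with t ht
      have h1 := ((contMDiffAt_frameMapSymm he.diffeo
        (z := (e α.1 + t * velocity e α, velocity e α)) ht).mdifferentiableAt
          (by simp)).hasMFDerivAt
      have h2 := h1.comp t (hl t).hasFDerivAt.hasMFDerivAt
      have hΦ := frameMap_frameMapSymm he.diffeo
        (z := (e α.1 + t * velocity e α, velocity e α)) ht
      have hbs : (b t).1 ∈ e.source := e.map_target ht
      have h3 := mfderiv_frameMapSymm he hbs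
      have hvel : velocity e (b t) = velocity e α := congrArg Prod.snd hΦ
      have hΦ' : frameMap e (b t) = (e α.1 + t * velocity e α, velocity e α) := hΦ
      rw [hvel, hΦ'] at h3
      rw [← h3]
      refine h2.congr_mfderiv ?_
      have h4 : ∀ L : ℝ × ℝ →L[ℝ] ℝ × ℝ, ∀ v : ℝ × ℝ,
          L.comp (ContinuousLinearMap.toSpanSingleton ℝ v) =
            (1 : ℝ →L[ℝ] ℝ).smulRight (L v) := by
        intro L v
        ext <;> simp
      exact h4 _ _

/-! ## The horizontal derivative -/

/-- The vector field `y ∂_s` on the plane. -/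
def planeDeriv (F : ℝ × ℝ → ℂ) (z : ℝ × ℝ) : ℂ := fderiv ℝ F z (z.2, 0)

theorem contDiffAt_planeDeriv {F : ℝ × ℝ → ℂ} {z : ℝ × ℝ} (hF : ContDiffAt ℝ ∞ F z) :
    ContDiffAt ℝ ∞ (planeDeriv F) z :=
  (hF.fderiv_right (m := ∞) (by simp)).clm_apply (contDiffAt_snd.prodMk contDiffAt_const)

theorem ContDiffAt.eventually_differentiableAt {F : ℝ × ℝ → ℂ} {z : ℝ × ℝ}
    (hF : ContDiffAt ℝ ∞ F z) : ∀ᶠ w in 𝓝 z, DifferentiableAt ℝ F w :=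
  ((hF.of_le (m := 1) (by simp)).eventually (by simp)).mono fun _ ht =>
    ht.differentiableAt (by simp)

theorem tendsto_frameMap (he : IsLocalDiffeo e) {p : TangentBundle 𝓘(ℝ, ℝ) M}
    (hp : p.1 ∈ e.source) : Tendsto (frameMap e) (𝓝 p) (𝓝 (frameMap e p)) :=
  (mdifferentiableAt_frameMap he hp).continuousAt.tendsto

/-- An equality of germs rather than of values, so that `X` can be iterated. -/
theorem horizontalDeriv_eventuallyEq (he : IsAffineChart D e) {p : TangentBundle 𝓘(ℝ, ℝ) M}
    (hp : p.1 ∈ e.source) {f : TangentBundle 𝓘(ℝ, ℝ) M → ℂ} {F : ℝ × ℝ → ℂ}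
    (hF : ContDiffAt ℝ ∞ F (frameMap e p)) (hf : f =ᶠ[𝓝 p] F ∘ frameMap e) :
    horizontalDeriv D f =ᶠ[𝓝 p] planeDeriv F ∘ frameMap e := by
  filter_upwards [eventually_eventually_nhds.mpr hf,
    (tendsto_frameMap he.diffeo hp).eventually (ContDiffAt.eventually_differentiableAt hF),
    eventually_fst_mem (e.open_source.mem_nhds hp)] with q hq hFq hqs
  have hq' : f =ᶠ[𝓝 q] F ∘ frameMap e := hq
  have h := mfderiv_comp_apply q hFq.mdifferentiableAt
    (mdifferentiableAt_frameMap he.diffeo hqs) (horizontal D q)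
  unfold horizontalDeriv
  rw [hq'.mfderiv_eq]
  refine h.trans ?_
  rw [he.horizontal_eq q hqs, mfderiv_eq_fderiv]
  rfl

theorem eventuallyEq_comp_frameMap (he : IsLocalDiffeo e) {p : TangentBundle 𝓘(ℝ, ℝ) M}
    (hp : p.1 ∈ e.source) {f : TangentBundle 𝓘(ℝ, ℝ) M → ℂ}
    (hf : ContMDiff 𝓘(ℝ, ℝ).tangent 𝓘(ℝ, ℂ) ∞ f) :
    ContDiffAt ℝ ∞ (f ∘ frameMapSymm e) (frameMap e p) ∧
      f =ᶠ[𝓝 p] (f ∘ frameMapSymm e) ∘ frameMap e := by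
  constructor
  · exact ((hf _).comp _ (contMDiffAt_frameMapSymm he (z := frameMap e p)
      (e.map_source hp))).contDiffAt
  · filter_upwards [eventually_fst_mem (e.open_source.mem_nhds hp)] with q hq
    simp [frameMapSymm_frameMap he hq]

end Affine

/-! ## Affine maps of the line -/

/-- The affine map `t ↦ s + t y`. -/
def affineHomeo (s y : ℝ) (hy : y ≠ 0) : OpenPartialHomeomorph ℝ ℝ :=
  ((Homeomorph.mulRight₀ y hy).trans (Homeomorph.addLeft s)).toOpenPartialHomeomorph

theorem isLocalDiffeo_affineHomeo (s y : ℝ) (hy : y ≠ 0) : IsLocalDiffeo (affineHomeo s y hy) := by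
  refine ⟨ContDiffOn.contMDiffOn ?_, ContDiffOn.contMDiffOn ?_⟩
  · have h : ContDiff ℝ ∞ fun t : ℝ => s + t * y := by fun_prop
    exact h.contDiffOn
  · have h : ContDiff ℝ ∞ fun r : ℝ => (-s + r) * y⁻¹ := by fun_prop
    exact h.contDiffOn

theorem iteratedDeriv_comp_affine (f : ℝ → ℝ) (s y : ℝ) (n : ℕ) :
    iteratedDeriv n (fun t => f (s + t * y)) =
      fun t => y ^ n * iteratedDeriv n f (s + t * y) := by
  induction n with
  | zero => simp
  | succ n ih =>
    ext t
    have h := deriv_comp_mul_left y (fun r => iteratedDeriv n f (s + r)) t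
    rw [deriv_comp_const_add, smul_eq_mul] at h
    simp only [mul_comm y] at h
    rw [iteratedDeriv_succ, ih, iteratedDeriv_succ, deriv_const_mul_field, h]
    ring

section Groupoid

variable {M : Type*} [TopologicalSpace M] [ChartedSpace ℝ M] [IsManifold 𝓘(ℝ, ℝ) ∞ M]

/-! ## Charts adapted to an element of the groupoid -/

/-- Affine charts at the range and at the source of the element `(ψ⁻¹, ψ̃ β)` of the groupoid. -/
structure AdaptedCharts (D : Connection M) (ψ : OpenPartialHomeomorph M M)
    (β : TangentBundle 𝓘(ℝ, ℝ) M) where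
  chart : OpenPartialHomeomorph M ℝ
  chart' : OpenPartialHomeomorph M ℝ
  diffeo : IsLocalDiffeo ψ
  affine : IsAffineChart D chart
  affine' : IsAffineChart D chart'
  mem_source : β.1 ∈ ψ.source
  mem_chart : β.1 ∈ chart.source
  mem_chart' : ψ β.1 ∈ chart'.source
  velocity_ne_zero : velocity chart β ≠ 0

theorem nonempty_adaptedCharts [T2Space M] (D : Connection M)
    [CovariantDerivative.ContMDiffCovariantDerivative D ∞] {ψ : OpenPartialHomeomorph M M}
    (hψ : IsLocalDiffeo ψ) {β : TangentBundle 𝓘(ℝ, ℝ) M} (hβ : β ∈ posFrames M)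
    (hs : β.1 ∈ ψ.source) : Nonempty (AdaptedCharts D ψ β) := by
  obtain ⟨e, h, he⟩ := exists_isAffineChart D β.1
  obtain ⟨e', h', he'⟩ := exists_isAffineChart D (ψ β.1)
  refine ⟨⟨e, e', hψ, he, he', hs, h, h', ?_⟩⟩
  rw [velocity_eq_mul he.diffeo h (mem_chart_source ℝ β.1), velocity_chartAt_self]
  refine mul_ne_zero ?_ (ne_of_gt hβ)
  exact ((isLocalDiffeo_chartAt β.1).symm.trans he.diffeo).deriv_ne_zero
    (r := chartAt ℝ β.1 β.1) (by simp [h])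

namespace AdaptedCharts

variable {D : Connection M} {ψ : OpenPartialHomeomorph M M} {β : TangentBundle 𝓘(ℝ, ℝ) M}
  (c : AdaptedCharts D ψ β)

/-- The local diffeomorphism in the affine charts. -/
def transition : OpenPartialHomeomorph ℝ ℝ := c.chart.symm.trans (ψ.trans c.chart')

theorem isLocalDiffeo_transition : IsLocalDiffeo c.transition :=
  c.affine.diffeo.symm.trans (c.diffeo.trans c.affine'.diffeo)

theorem mem_transition_source {x : M} (hx : x ∈ c.chart.source) (hxψ : x ∈ ψ.source)
    (hx' : ψ x ∈ c.chart'.source) : c.chart x ∈ c.transition.source := by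
  simp [transition, hx, hxψ, hx']

theorem base_mem : c.chart β.1 ∈ c.transition.source :=
  c.mem_transition_source c.mem_chart c.mem_source c.mem_chart'

theorem contDiffAt_transition {r : ℝ} (hr : r ∈ c.transition.source) : ContDiffAt ℝ ∞ c.transition r :=
  (c.isLocalDiffeo_transition.contMDiffAt hr).contDiffAt

theorem velocity_tangentMap {q : TangentBundle 𝓘(ℝ, ℝ) M} (hq : q.1 ∈ c.chart.source)
    (hqψ : q.1 ∈ ψ.source) (hq' : ψ q.1 ∈ c.chart'.source) :
    velocity c.chart' (tangentMap 𝓘(ℝ, ℝ) 𝓘(ℝ, ℝ) ψ q) =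
      deriv c.transition (c.chart q.1) * velocity c.chart q := by
  have h1 := mfderiv_comp_apply q.1 (c.affine'.diffeo.mdifferentiableAt hq')
    (c.diffeo.mdifferentiableAt hqψ) q.2
  refine Eq.trans h1.symm ?_
  have hev : c.chart' ∘ ψ =ᶠ[𝓝 q.1] c.transition ∘ c.chart := by
    filter_upwards [c.chart.open_source.mem_nhds hq] with z hz
    simp [transition, c.chart.left_inv hz]
  have hd := (c.contDiffAt_transition (c.mem_transition_source hq hqψ hq')).differentiableAt (by simp)
  have h2 := mfderiv_comp_apply q.1 hd.mdifferentiableAt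
    (c.affine.diffeo.mdifferentiableAt hq) q.2
  rw [hev.mfderiv_eq]
  refine h2.trans ?_
  rw [mfderiv_eq_fderiv]
  have h' : ∀ v : ℝ, fderiv ℝ c.transition (c.chart q.1) v = deriv c.transition (c.chart q.1) * v := by
    intro v
    rw [fderiv_eq_smul_deriv, smul_eq_mul, mul_comm]
  exact h' _

theorem eventually_mem : ∀ᶠ q : TangentBundle 𝓘(ℝ, ℝ) M in 𝓝 β,
    q.1 ∈ c.chart.source ∧ q.1 ∈ ψ.source ∧ ψ q.1 ∈ c.chart'.source := by
  have h : ∀ᶠ x in 𝓝 β.1, x ∈ c.chart.source ∧ x ∈ ψ.source ∧ ψ x ∈ c.chart'.source := by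
    filter_upwards [c.chart.open_source.mem_nhds c.mem_chart, ψ.open_source.mem_nhds c.mem_source,
      (ψ.continuousAt c.mem_source).tendsto.eventually
        (c.chart'.open_source.mem_nhds c.mem_chart')] with x h1 h2 h3 using ⟨h1, h2, h3⟩
  exact eventually_fst_mem h

/-- The logarithmic derivative of `h'`, where `h` is the local diffeomorphism in affine charts. -/
def nonlinearity (r : ℝ) : ℝ := deriv (deriv c.transition) r / deriv c.transition r

theorem contDiffAt_nonlinearity {r : ℝ} (hr : r ∈ c.transition.source) : ContDiffAt ℝ ∞ c.nonlinearity r :=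
  (contDiffAt_deriv (contDiffAt_deriv (c.contDiffAt_transition hr))).div
    (contDiffAt_deriv (c.contDiffAt_transition hr)) (c.isLocalDiffeo_transition.deriv_ne_zero hr)

/-- The lift of `ψ` is `(s, y) ↦ (h s, h' s * y)` in affine charts. Pulling back `dy / y` adds
`(h''/h') ds`, whose value on `y ∂_s` is `y h''/h'`. -/
theorem cocycle_eventuallyEq : ∀ᶠ q in 𝓝 β,
    cocycle D ψ q = velocity c.chart q * c.nonlinearity (c.chart q.1) := by
  filter_upwards [eventually_eventually_nhds.mpr c.eventually_mem] with q hq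
  obtain ⟨hq1, hq2, hq3⟩ := hq.self_of_nhds
  have hr := c.mem_transition_source hq1 hq2 hq3
  have hK := hasFDerivAt_prolongation (y := velocity c.chart q) (c.contDiffAt_transition hr)
  have hev : frameMap c.chart' ∘ tangentMap 𝓘(ℝ, ℝ) 𝓘(ℝ, ℝ) ψ =ᶠ[𝓝 q]
      (fun z : ℝ × ℝ => (c.transition z.1, deriv c.transition z.1 * z.2)) ∘ frameMap c.chart := by
    filter_upwards [hq] with w hw
    simp only [Function.comp_apply, frameMap]
    rw [c.velocity_tangentMap hw.1 hw.2.1 hw.2.2]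
    simp [transition, tangentMap, c.chart.left_inv hw.1]
  have hΦ := (mdifferentiableAt_frameMap c.affine.diffeo hq1).hasMFDerivAt
  have hψ := ((c.diffeo.contMDiffAt_tangentMap hq2).mdifferentiableAt (by simp)).hasMFDerivAt
  have hΦ' := (mdifferentiableAt_frameMap c.affine'.diffeo
    (p := tangentMap 𝓘(ℝ, ℝ) 𝓘(ℝ, ℝ) ψ q) hq3).hasMFDerivAt
  have hu := hasMFDerivAt_unique (hΦ'.comp q hψ)
    ((HasMFDerivAt.comp q (HasFDerivAt.hasMFDerivAt hK) hΦ).congr_of_eventuallyEq hev)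
  have hu1 := congrArg (fun L : ℝ × ℝ →L[ℝ] ℝ × ℝ => (L (horizontal D q)).2) hu
  have hX := c.affine.horizontal_eq q hq1
  have h1 : connForm D q (horizontal D q) = 0 := by
    rw [c.affine.connForm_eq q _ hq1, hX]
    simp
  have h2 := c.affine'.connForm_eq (tangentMap 𝓘(ℝ, ℝ) 𝓘(ℝ, ℝ) ψ q)
    (mfderiv 𝓘(ℝ, ℝ).tangent 𝓘(ℝ, ℝ).tangent (tangentMap 𝓘(ℝ, ℝ) 𝓘(ℝ, ℝ) ψ) q (horizontal D q)) hq3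
  rw [cocycle, h1, sub_zero, h2, c.velocity_tangentMap hq1 hq2 hq3]
  have h3 : (mfderiv 𝓘(ℝ, ℝ).tangent 𝓘(ℝ, ℝ × ℝ) (frameMap c.chart')
      (tangentMap 𝓘(ℝ, ℝ) 𝓘(ℝ, ℝ) ψ q) (mfderiv 𝓘(ℝ, ℝ).tangent 𝓘(ℝ, ℝ).tangent
        (tangentMap 𝓘(ℝ, ℝ) 𝓘(ℝ, ℝ) ψ) q (horizontal D q)) : ℝ × ℝ).2 =
      velocity c.chart q * (deriv (deriv c.transition) (c.chart q.1) * velocity c.chart q) := by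
    refine hu1.trans ?_
    have h4 : ∀ (a b y : ℝ) (v : ℝ × ℝ), v = (y, 0) →
        (((a • ContinuousLinearMap.fst ℝ ℝ ℝ).prod (a • ContinuousLinearMap.snd ℝ ℝ ℝ +
          y • b • ContinuousLinearMap.fst ℝ ℝ ℝ)) v).2 = y * (b * y) := by
      rintro a b y v rfl
      simp
    exact h4 _ _ _ _ hX
  rw [h3, nonlinearity]
  have hne := c.isLocalDiffeo_transition.deriv_ne_zero hr
  -- The velocity is known to be nonzero only at `β`; where it vanishes both sides are zero.
  by_cases hv : velocity c.chart q = 0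
  · simp [hv]
  · field_simp

/-! ## The operators in affine charts -/

/-- The function `y ^ (n + 1) (log h')⁽ⁿ⁺¹⁾` by which `δₙ₊₁` acts. -/
def symbol (n : ℕ) (z : ℝ × ℝ) : ℂ := ((z.2 ^ (n + 1) * iteratedDeriv n c.nonlinearity z.1 : ℝ) : ℂ)

theorem contDiffAt_symbol (n : ℕ) {z : ℝ × ℝ} (hz : z.1 ∈ c.transition.source) :
    ContDiffAt ℝ ∞ (c.symbol n) z := by
  have h1 : ContDiffAt ℝ ∞ (fun z : ℝ × ℝ => iteratedDeriv n c.nonlinearity z.1) z :=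
    (contDiffAt_iteratedDeriv (c.contDiffAt_nonlinearity hz) n).comp z contDiffAt_fst
  have h2 : ContDiffAt ℝ ∞
      (fun z : ℝ × ℝ => z.2 ^ (n + 1) * iteratedDeriv n c.nonlinearity z.1) z :=
    (contDiffAt_snd.pow _).mul h1
  exact Complex.ofRealCLM.contDiff.contDiffAt.comp z h2

/-- `y ∂_s` differentiates only in the base and contributes one more factor `y`. -/
theorem planeDeriv_symbol (n : ℕ) {z : ℝ × ℝ} (hz : z.1 ∈ c.transition.source) :
    planeDeriv (c.symbol n) z = c.symbol (n + 1) z := by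
  have h1 : HasDerivAt (iteratedDeriv n c.nonlinearity) (iteratedDeriv (n + 1) c.nonlinearity z.1) z.1 := by
    rw [iteratedDeriv_succ]
    exact ((contDiffAt_iteratedDeriv (c.contDiffAt_nonlinearity hz) n).differentiableAt
      (by simp)).hasDerivAt
  have h2 := h1.comp_hasFDerivAt z (hasFDerivAt_fst (𝕜 := ℝ) (E := ℝ) (F := ℝ))
  have h3 := ((hasFDerivAt_snd (𝕜 := ℝ) (E := ℝ) (F := ℝ) (p := z)).pow (n + 1)).mul h2
  have h4 := (Complex.ofRealCLM.hasFDerivAt).comp z h3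
  rw [planeDeriv]
  refine (congrArg (fun L : ℝ × ℝ →L[ℝ] ℂ => L (z.2, 0)) h4.fderiv).trans ?_
  simp [symbol]
  ring

theorem planeDeriv_mul {F G : ℝ × ℝ → ℂ} {z : ℝ × ℝ} (hF : DifferentiableAt ℝ F z)
    (hG : DifferentiableAt ℝ G z) :
    planeDeriv (fun w => F w * G w) z = planeDeriv F z * G z + F z * planeDeriv G z := by
  rw [planeDeriv, fderiv_fun_mul hF hG]
  simp [planeDeriv]
  ring

end AdaptedCharts

variable {D : Connection M} {Γ : StructureGroupoid M}

theorem opX_apply {e : OpenPartialHomeomorph M ℝ} (he : IsAffineChart D e) {g : FrameGroupoid Γ}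
    (hg : g.range.1.1 ∈ e.source) {a : GroupoidFun Γ} {F : ℝ × ℝ → ℂ}
    (hF : ContDiffAt ℝ ∞ F (frameMap e g.range.1))
    (ha : a g = ((F ∘ frameMap e : _ → ℂ) : Germ (𝓝 g.range.1) ℂ)) :
    opX D a g = ((planeDeriv F ∘ frameMap e : _ → ℂ) : Germ (𝓝 g.range.1) ℂ) := by
  rw [opX, ha]
  exact Germ.coe_eq.mpr (horizontalDeriv_eventuallyEq he hg hF EventuallyEq.rfl)

/-- By the Leibniz rule `[X, σ] = X σ` for multiplication by `σ`, and `X` takes each symbol to the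
next. All `a` are treated at once, since the commutator also needs the case of `opX D a`. -/
theorem opDelta_apply {g : FrameGroupoid Γ} (c : AdaptedCharts D g.rep g.range.1) (n : ℕ) :
    ∀ (a : GroupoidFun Γ) (F : ℝ × ℝ → ℂ), ContDiffAt ℝ ∞ F (frameMap c.chart g.range.1) →
      a g = ((F ∘ frameMap c.chart : _ → ℂ) : Germ (𝓝 g.range.1) ℂ) →
      opDelta D n a g = (((fun z => c.symbol n z * F z) ∘ frameMap c.chart : _ → ℂ) :
        Germ (𝓝 g.range.1) ℂ) := by
  have htend := tendsto_frameMap c.affine.diffeo c.mem_chart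
  have hsrc : ∀ᶠ z : ℝ × ℝ in 𝓝 (frameMap c.chart g.range.1), z.1 ∈ c.transition.source :=
    continuousAt_fst.tendsto.eventually (c.transition.open_source.mem_nhds c.base_mem)
  induction n with
  | zero =>
    intro a F hF ha
    change _ * a g = _
    rw [ha, ← Germ.coe_mul]
    refine Germ.coe_eq.mpr ?_
    filter_upwards [c.cocycle_eventuallyEq] with q hq
    simp [hq, AdaptedCharts.symbol, frameMap]
  | succ n ih =>
    intro a F hF ha
    have hs := c.contDiffAt_symbol n (z := frameMap c.chart g.range.1) c.base_mem
    have h1 := opX_apply c.affine c.mem_chart (hs.mul hF) (ih a F hF ha)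
    have h2 := ih (opX D a) _ (contDiffAt_planeDeriv hF) (opX_apply c.affine c.mem_chart hF ha)
    change opX D (opDelta D n a) g - opDelta D n (opX D a) g = _
    rw [h1, h2, ← Germ.coe_sub]
    refine Germ.coe_eq.mpr ?_
    filter_upwards [htend.eventually hsrc,
      htend.eventually (ContDiffAt.eventually_differentiableAt hF),
      htend.eventually (ContDiffAt.eventually_differentiableAt hs)] with q hq hqF hqs
    simp only [Pi.sub_apply, Function.comp_apply]
    rw [AdaptedCharts.planeDeriv_mul hqs hqF, c.planeDeriv_symbol n hq]
    ring

theorem exists_germ_of_mem_crossedProduct {e : OpenPartialHomeomorph M ℝ} (he : IsLocalDiffeo e)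
    {g : FrameGroupoid Γ} (hg : g.range.1.1 ∈ e.source) {a : GroupoidFun Γ}
    (ha : a ∈ crossedProduct Γ) : ∃ F : ℝ × ℝ → ℂ, ContDiffAt ℝ ∞ F (frameMap e g.range.1) ∧
      a g = ((F ∘ frameMap e : _ → ℂ) : Germ (𝓝 g.range.1) ℂ) := by
  have hzero : ∃ F : ℝ × ℝ → ℂ, ContDiffAt ℝ ∞ F (frameMap e g.range.1) ∧
      (0 : Germ (𝓝 g.range.1) ℂ) = ((F ∘ frameMap e : _ → ℂ) : Germ (𝓝 g.range.1) ℂ) :=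
    ⟨0, contDiffAt_const, rfl⟩
  induction ha using Submodule.span_induction with
  | mem a h =>
    obtain ⟨ψ, -, f, ⟨hf, -, -⟩, rfl⟩ := h
    unfold monomial
    split_ifs
    · obtain ⟨h1, h2⟩ := eventuallyEq_comp_frameMap he hg hf
      exact ⟨_, h1, Germ.coe_eq.mpr h2⟩
    · exact hzero
  | zero => exact hzero
  | add a b _ _ iha ihb =>
    obtain ⟨F, hF, h1⟩ := iha
    obtain ⟨G, hG, h2⟩ := ihb
    refine ⟨F + G, hF.add hG, ?_⟩
    rw [Pi.add_apply, h1, h2]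
    rfl
  | smul r a _ iha =>
    obtain ⟨F, hF, h1⟩ := iha
    refine ⟨r • F, contDiffAt_const.smul hF, ?_⟩
    rw [Pi.smul_apply, h1]
    rfl

end Groupoid

section Groupoid

variable {M : Type*} [TopologicalSpace M] [ChartedSpace ℝ M] [IsManifold 𝓘(ℝ, ℝ) ∞ M]
  {D : Connection M} {Γ : StructureGroupoid M}

/-! ## The germ of an element of the groupoid -/

/-- `θ` represents the germ `exp_β⁻¹ ∘ ψ⁻¹ ∘ exp_{ψ̃ β}`. -/
def IsCanonicalGerm (D : Connection M) (ψ : OpenPartialHomeomorph M M)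
    (β : TangentBundle 𝓘(ℝ, ℝ) M) (θ : DiffeoRep) : Prop :=
  ∃ cα cβ : ℝ → M, IsExpCurve D (tangentMap 𝓘(ℝ, ℝ) 𝓘(ℝ, ℝ) ψ β) cα ∧ IsExpCurve D β cβ ∧
    (cβ ∘ θ.toHomeo) =ᶠ[𝓝 0] (ψ.symm ∘ cα)

namespace AdaptedCharts

variable {ψ : OpenPartialHomeomorph M M} {β : TangentBundle 𝓘(ℝ, ℝ) M} (c : AdaptedCharts D ψ β)

theorem velocity_source : velocity c.chart' (tangentMap 𝓘(ℝ, ℝ) 𝓘(ℝ, ℝ) ψ β) =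
    deriv c.transition (c.chart β.1) * velocity c.chart β :=
  c.velocity_tangentMap c.mem_chart c.mem_source c.mem_chart'

theorem deriv_transition_ne_zero : deriv c.transition (c.chart β.1) ≠ 0 :=
  c.isLocalDiffeo_transition.deriv_ne_zero c.base_mem

theorem velocity_source_ne_zero :
    velocity c.chart' (tangentMap 𝓘(ℝ, ℝ) 𝓘(ℝ, ℝ) ψ β) ≠ 0 := by
  rw [c.velocity_source]
  exact mul_ne_zero c.deriv_transition_ne_zero c.velocity_ne_zero

/-- The exponential map at the range, in the affine chart. -/
def expRange : OpenPartialHomeomorph ℝ ℝ :=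
  affineHomeo (c.chart β.1) (velocity c.chart β) c.velocity_ne_zero

/-- The exponential map at the source, in the affine chart. -/
def expSource : OpenPartialHomeomorph ℝ ℝ :=
  affineHomeo (c.chart' (ψ β.1)) (velocity c.chart' (tangentMap 𝓘(ℝ, ℝ) 𝓘(ℝ, ℝ) ψ β))
    c.velocity_source_ne_zero

/-- The local diffeomorphism `exp_{ψ̃ β}⁻¹ ∘ ψ ∘ exp_β`. -/
def homeo : OpenPartialHomeomorph ℝ ℝ := (c.expRange.trans c.transition).trans c.expSource.symm

theorem expRange_apply (t : ℝ) : c.expRange t = c.chart β.1 + t * velocity c.chart β := rfl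

theorem homeo_apply (t : ℝ) : c.homeo t =
    (-c.chart' (ψ β.1) + c.transition (c.chart β.1 + t * velocity c.chart β)) *
      (velocity c.chart' (tangentMap 𝓘(ℝ, ℝ) 𝓘(ℝ, ℝ) ψ β))⁻¹ := rfl

theorem mem_homeo_source (t : ℝ) : t ∈ c.homeo.source ↔
    c.chart β.1 + t * velocity c.chart β ∈ c.transition.source := by
  have h1 : ∀ r, r ∈ c.expSource.target := fun r => Set.mem_univ r
  have h2 : ∀ r, r ∈ c.expRange.source := fun r => Set.mem_univ r
  simp only [homeo, OpenPartialHomeomorph.trans_source, OpenPartialHomeomorph.symm_source,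
    Set.mem_inter_iff, Set.mem_preimage, h1, h2, true_and, and_true]
  rfl

theorem hasDerivAt_homeo {t : ℝ} (ht : t ∈ c.homeo.source) : HasDerivAt c.homeo
    (deriv c.transition (c.chart β.1 + t * velocity c.chart β) * (velocity c.chart β *
      (velocity c.chart' (tangentMap 𝓘(ℝ, ℝ) 𝓘(ℝ, ℝ) ψ β))⁻¹)) t := by
  have h1 := ((c.contDiffAt_transition ((c.mem_homeo_source t).mp ht)).differentiableAt
    (by simp)).hasDerivAt
  have h2 : HasDerivAt (fun t : ℝ => c.chart β.1 + t * velocity c.chart β)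
      (velocity c.chart β) t := by
    simpa using ((hasDerivAt_id t).mul_const (velocity c.chart β)).const_add (c.chart β.1)
  have h3 := ((h1.comp t h2).const_add (-c.chart' (ψ β.1))).mul_const
    (velocity c.chart' (tangentMap 𝓘(ℝ, ℝ) 𝓘(ℝ, ℝ) ψ β))⁻¹
  refine h3.congr_deriv ?_
  ring

/-- The local diffeomorphism `exp_{ψ̃ β}⁻¹ ∘ ψ ∘ exp_β`, which is tangent to the identity. -/
def rep : DiffeoRep where
  toHomeo := c.homeo
  zero_mem := by
    rw [c.mem_homeo_source]
    simpa using c.base_mem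
  map_zero := by
    rw [homeo_apply]
    simp [transition, c.chart.left_inv c.mem_chart]
  smooth := ((((isLocalDiffeo_affineHomeo _ _ _).trans c.isLocalDiffeo_transition).trans
    (isLocalDiffeo_affineHomeo _ _ _).symm).1).contDiffOn
  smooth_symm := ((((isLocalDiffeo_affineHomeo _ _ _).trans c.isLocalDiffeo_transition).trans
    (isLocalDiffeo_affineHomeo _ _ _).symm).2).contDiffOn
  deriv_zero := by
    have h0 : (0 : ℝ) ∈ c.homeo.source := by
      rw [c.mem_homeo_source]
      simpa using c.base_mem
    rw [(c.hasDerivAt_homeo h0).deriv, c.velocity_source, zero_mul, add_zero]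
    have h1 := c.deriv_transition_ne_zero
    have h2 := c.velocity_ne_zero
    field_simp

theorem isExpCurve_range (γ : ℝ → M) :
    IsExpCurve D β γ ↔ γ =ᶠ[𝓝 0] fun t => c.chart.symm (c.expRange t) :=
  isExpCurve_iff c.affine c.mem_chart γ

theorem isExpCurve_source (γ : ℝ → M) : IsExpCurve D (tangentMap 𝓘(ℝ, ℝ) 𝓘(ℝ, ℝ) ψ β) γ ↔
    γ =ᶠ[𝓝 0] fun t => c.chart'.symm (c.expSource t) :=
  isExpCurve_iff c.affine' (α := tangentMap 𝓘(ℝ, ℝ) 𝓘(ℝ, ℝ) ψ β) c.mem_chart' γ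

/-- The equation `exp_β ∘ θ = ψ⁻¹ ∘ exp_{ψ̃ β}` for `θ = homeo⁻¹`; the membership allows
`c.chart.symm` to be cancelled. -/
theorem eventually_homeo_symm : ∀ᶠ t in 𝓝 (0 : ℝ),
    c.expRange (c.homeo.symm t) ∈ c.chart.target ∧
      c.chart.symm (c.expRange (c.homeo.symm t)) = ψ.symm (c.chart'.symm (c.expSource t)) := by
  filter_upwards [c.homeo.open_target.mem_nhds c.rep.zero_mem_target] with t ht
  have h1 := (c.mem_homeo_source _).mp (c.homeo.map_target ht)
  have h2 := c.homeo.right_inv ht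
  rw [← c.expRange_apply] at h1
  set r := c.expRange (c.homeo.symm t) with hr
  simp only [transition, OpenPartialHomeomorph.trans_source, OpenPartialHomeomorph.symm_source,
    Set.mem_inter_iff, Set.mem_preimage] at h1
  obtain ⟨h3, h4, h5⟩ := h1
  refine ⟨h3, ?_⟩
  have h6 : c.expSource.symm (c.chart' (ψ (c.chart.symm r))) = t := h2
  have h7 := c.expSource.right_inv (x := c.chart' (ψ (c.chart.symm r))) (Set.mem_univ _)
  rw [h6] at h7
  rw [h7, c.chart'.left_inv h5, ψ.left_inv h4]

/-- `exp_β` is injective near `0`, so its defining equation can be solved for `θ`. As the left side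
does not mention charts, the germ of `c.rep` is independent of them. -/
theorem isCanonicalGerm_iff (θ : DiffeoRep) :
    IsCanonicalGerm D ψ β θ ↔ DiffeoGerm.mk θ = (DiffeoGerm.mk c.rep)⁻¹ := by
  have hinv : (DiffeoGerm.mk θ = (DiffeoGerm.mk c.rep)⁻¹) ↔
      (θ.toHomeo : ℝ → ℝ) =ᶠ[𝓝 0] c.homeo.symm :=
    Quotient.eq (r := DiffeoRep.setoid) (x := θ) (y := c.rep.inv)
  rw [hinv]
  constructor
  · rintro ⟨cα, cβ, hα, hβ, h⟩
    have hα' := (c.isExpCurve_source cα).mp hα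
    have hβ' := θ.tendsto.eventually ((c.isExpCurve_range cβ).mp hβ)
    have hmem : ∀ᶠ t in 𝓝 (0 : ℝ), c.expRange (θ.toHomeo t) ∈ c.chart.target := by
      have h1 : ContinuousAt c.expRange 0 := c.expRange.continuousAt (Set.mem_univ _)
      refine (h1.tendsto.comp θ.tendsto).eventually (c.chart.open_target.mem_nhds ?_)
      simpa [expRange_apply] using c.chart.map_source c.mem_chart
    filter_upwards [h, hα', hβ', hmem, c.eventually_homeo_symm] with t h1 h2 h3 h4 h5
    simp only [Function.comp_apply] at h1
    rw [h3, h2, ← h5.2] at h1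
    exact c.expRange.injOn (Set.mem_univ _) (Set.mem_univ _) (c.chart.symm.injOn h4 h5.1 h1)
  · intro h
    refine ⟨_, _, (c.isExpCurve_source _).mpr EventuallyEq.rfl,
      (c.isExpCurve_range _).mpr EventuallyEq.rfl, ?_⟩
    filter_upwards [h, c.eventually_homeo_symm] with t h1 h2
    simp only [Function.comp_apply]
    rw [h1, h2.2]

/-- The coordinates of the germ `exp_{ψ̃ β}⁻¹ ∘ ψ ∘ exp_β`. -/
theorem coord_rep (n : ℕ) : ((DiffeoGerm.coord (n + 1) (DiffeoGerm.mk c.rep) : ℝ) : ℂ) =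
    c.symbol n (frameMap c.chart β) := by
  -- The derivative of `homeo` is a nonzero constant times `h'` along an affine line; the
  -- logarithmic derivative ignores the constant and every sign.
  have hev : deriv (fun t => Real.log (deriv c.homeo t)) =ᶠ[𝓝 0]
      fun t => velocity c.chart β * c.nonlinearity (c.chart β.1 + t * velocity c.chart β) := by
    filter_upwards [c.homeo.open_source.mem_nhds c.rep.zero_mem] with t ht
    have h1 : deriv c.homeo =ᶠ[𝓝 t] fun t =>
        deriv c.transition (c.chart β.1 + t * velocity c.chart β) * (velocity c.chart β *
          (velocity c.chart' (tangentMap 𝓘(ℝ, ℝ) 𝓘(ℝ, ℝ) ψ β))⁻¹) := by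
      filter_upwards [c.homeo.open_source.mem_nhds ht] with s hs using (c.hasDerivAt_homeo hs).deriv
    have hm := (c.mem_homeo_source t).mp ht
    have h2 := ((contDiffAt_deriv (c.contDiffAt_transition hm)).differentiableAt (by simp)).hasDerivAt
    have h3 : HasDerivAt (fun t : ℝ => c.chart β.1 + t * velocity c.chart β)
        (velocity c.chart β) t := by
      simpa using ((hasDerivAt_id t).mul_const (velocity c.chart β)).const_add (c.chart β.1)
    have h4 := (h2.comp t h3).mul_const (velocity c.chart β *
      (velocity c.chart' (tangentMap 𝓘(ℝ, ℝ) 𝓘(ℝ, ℝ) ψ β))⁻¹)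
    have hne := c.isLocalDiffeo_transition.deriv_ne_zero hm
    have hv := c.velocity_ne_zero
    have hv' := c.velocity_source_ne_zero
    have h5 : HasDerivAt (deriv c.homeo) _ t := h4.congr_of_eventuallyEq h1
    have hne' : deriv c.homeo t ≠ 0 := by
      rw [h1.self_of_nhds]
      exact mul_ne_zero hne (mul_ne_zero hv (inv_ne_zero hv'))
    rw [(h5.log hne').deriv, h1.self_of_nhds, nonlinearity]
    field_simp
  have h1 : DiffeoGerm.coord (n + 1) (DiffeoGerm.mk c.rep) =
      iteratedDeriv (n + 1) (fun t => Real.log (deriv c.homeo t)) 0 := rfl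
  rw [h1, iteratedDeriv_succ', hev.iteratedDeriv_eq n, iteratedDeriv_const_mul_field,
    iteratedDeriv_comp_affine, symbol]
  simp only [frameMap, zero_mul, add_zero]
  congr 1
  ring

end AdaptedCharts

theorem IsExpCurve.tendsto {α : TangentBundle 𝓘(ℝ, ℝ) M} {γ : ℝ → M} (h : IsExpCurve D α γ) :
    Tendsto γ (𝓝 0) (𝓝 α.1) := by
  obtain ⟨b, rfl, hb, hγ⟩ := h
  have h1 : ContinuousAt b 0 := hb.self_of_nhds.continuousAt
  have h2 := (FiberBundle.continuous_proj ℝ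
    (TangentSpace 𝓘(ℝ, ℝ) : M → Type _)).continuousAt.tendsto.comp h1.tendsto
  exact h2.congr' hγ.symm

theorem IsExpCurve.eventuallyEq [T2Space M] [CovariantDerivative.ContMDiffCovariantDerivative D ∞]
    {α : TangentBundle 𝓘(ℝ, ℝ) M} {γ γ' : ℝ → M} (h : IsExpCurve D α γ) (h' : IsExpCurve D α γ') :
    γ =ᶠ[𝓝 0] γ' := by
  obtain ⟨e, he, hD⟩ := exists_isAffineChart D α.1
  exact ((isExpCurve_iff hD he γ).mp h).trans ((isExpCurve_iff hD he γ').mp h').symm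

omit [ChartedSpace ℝ M] [IsManifold 𝓘(ℝ, ℝ) ∞ M] in
theorem symm_eventuallyEq {ψ ψ' : OpenPartialHomeomorph M M} {x : M} (hx : x ∈ ψ.source)
    (hx' : x ∈ ψ'.source) (h : (ψ : M → M) =ᶠ[𝓝 x] ψ') :
    (ψ.symm : M → M) =ᶠ[𝓝 (ψ x)] ψ'.symm := by
  have h1 := ψ.symm.continuousAt (ψ.map_source hx)
  have h2 : Tendsto ψ.symm (𝓝 (ψ x)) (𝓝 x) := by
    have h3 := h1.tendsto
    rwa [ψ.left_inv hx] at h3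
  filter_upwards [h2.eventually h, h2.eventually (ψ'.open_source.mem_nhds hx'),
    ψ.open_target.mem_nhds (ψ.map_source hx)] with y hy hy' hyt
  rw [ψ.right_inv hyt] at hy
  conv_rhs => rw [hy]
  rw [ψ'.left_inv hy']

/-- The germ of `ψ` determines both its tangent map at `β` and the germ of its inverse. -/
theorem IsCanonicalGerm.congr {ψ ψ' : OpenPartialHomeomorph M M} {β : TangentBundle 𝓘(ℝ, ℝ) M}
    {θ : DiffeoRep} (h : IsCanonicalGerm D ψ β θ) (hs : β.1 ∈ ψ.source) (hs' : β.1 ∈ ψ'.source)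
    (he : (ψ : M → M) =ᶠ[𝓝 β.1] ψ') : IsCanonicalGerm D ψ' β θ := by
  obtain ⟨cα, cβ, hα, hβ, h⟩ := h
  have ht : tangentMap 𝓘(ℝ, ℝ) 𝓘(ℝ, ℝ) ψ' β = tangentMap 𝓘(ℝ, ℝ) 𝓘(ℝ, ℝ) ψ β := by
    have h1 : ∀ (x' : M) (v' : ℝ), x' = ψ β.1 →
        v' = (mfderiv 𝓘(ℝ, ℝ) 𝓘(ℝ, ℝ) ψ β.1 β.2 : ℝ) →
        (⟨x', v'⟩ : TangentBundle 𝓘(ℝ, ℝ) M) = ⟨ψ β.1, mfderiv 𝓘(ℝ, ℝ) 𝓘(ℝ, ℝ) ψ β.1 β.2⟩ := by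
      rintro x' v' rfl rfl
      rfl
    refine h1 _ _ he.self_of_nhds.symm ?_
    exact congrArg (fun L : ℝ →L[ℝ] ℝ => L β.2) he.symm.mfderiv_eq
  refine ⟨cα, cβ, ht ▸ hα, hβ, h.trans ?_⟩
  have h2 : Tendsto cα (𝓝 0) (𝓝 (ψ β.1)) := hα.tendsto
  exact h2.eventually (symm_eventuallyEq hs hs' he)

/-- `exp_β θ₁ θ₂ = ψ₁⁻¹ exp_{ψ̃₁ β} θ₂ = ψ₁⁻¹ ψ₂⁻¹ exp_{ψ̃₂ ψ̃₁ β}`; the two exponential curves at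
the middle frame agree by uniqueness of geodesics. -/
theorem IsCanonicalGerm.mul [T2Space M] [CovariantDerivative.ContMDiffCovariantDerivative D ∞]
    {ψ₁ ψ₂ : OpenPartialHomeomorph M M} {β : TangentBundle 𝓘(ℝ, ℝ) M} {θ₁ θ₂ : DiffeoRep}
    (hψ₁ : IsLocalDiffeo ψ₁) (hψ₂ : IsLocalDiffeo ψ₂) (hβ : β.1 ∈ (ψ₁.trans ψ₂).source)
    (h₁ : IsCanonicalGerm D ψ₁ β θ₁)
    (h₂ : IsCanonicalGerm D ψ₂ (tangentMap 𝓘(ℝ, ℝ) 𝓘(ℝ, ℝ) ψ₁ β) θ₂) :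
    IsCanonicalGerm D (ψ₁.trans ψ₂) β (θ₁.mul θ₂) := by
  obtain ⟨cα₁, cβ₁, hα₁, hβ₁, e₁⟩ := h₁
  obtain ⟨cα₂, cβ₂, hα₂, hβ₂, e₂⟩ := h₂
  rw [OpenPartialHomeomorph.trans_source] at hβ
  have ht : tangentMap 𝓘(ℝ, ℝ) 𝓘(ℝ, ℝ) (ψ₁.trans ψ₂) β =
      tangentMap 𝓘(ℝ, ℝ) 𝓘(ℝ, ℝ) ψ₂ (tangentMap 𝓘(ℝ, ℝ) 𝓘(ℝ, ℝ) ψ₁ β) :=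
    tangentMap_comp_at β (hψ₂.mdifferentiableAt hβ.2) (hψ₁.mdifferentiableAt hβ.1)
  refine ⟨cα₂, cβ₁, ht ▸ hα₂, hβ₁, ?_⟩
  filter_upwards [θ₂.tendsto.eventually e₁, θ₂.tendsto.eventually (hα₁.eventuallyEq hβ₂), e₂]
    with t h1 h2 h3
  simp only [Function.comp_apply] at h1 h3
  change cβ₁ (θ₁.toHomeo (θ₂.toHomeo t)) = ψ₁.symm (ψ₂.symm (cα₂ t))
  rw [h1, h2, h3]

omit [IsManifold 𝓘(ℝ, ℝ) ∞ M] in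
theorem IsSmoothOriented.isLocalDiffeo (hΓ : IsSmoothOriented Γ) {ψ : OpenPartialHomeomorph M M}
    (hψ : ψ ∈ Γ) : IsLocalDiffeo ψ :=
  ⟨(hΓ ψ hψ).1, (hΓ ψ.symm (Γ.symm hψ)).1⟩

namespace FrameGroupoid

omit [IsManifold 𝓘(ℝ, ℝ) ∞ M] in
theorem rep_mem (g : FrameGroupoid Γ) : g.rep ∈ Γ := (Classical.choose_spec g.exists_rep).1

omit [IsManifold 𝓘(ℝ, ℝ) ∞ M] in
theorem mem_rep_source (g : FrameGroupoid Γ) : g.range.1.1 ∈ g.rep.source :=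
  (Classical.choose_spec g.exists_rep).2.1

omit [IsManifold 𝓘(ℝ, ℝ) ∞ M] in
theorem germ_rep (g : FrameGroupoid Γ) :
    g.germ = ((g.rep : M → M) : Germ (𝓝 g.range.1.1) M) :=
  (Classical.choose_spec g.exists_rep).2.2

omit [IsManifold 𝓘(ℝ, ℝ) ∞ M] in
theorem mk'_rep (g : FrameGroupoid Γ) : mk' g.rep g.rep_mem g.range g.mem_rep_source = g := by
  obtain ⟨β, germ, h⟩ := g
  simp only [mk']
  congr 1
  exact (germ_rep ⟨β, germ, h⟩).symm

end FrameGroupoid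

/-! ### The canonical homomorphism and the formula for its coordinates -/

section

variable [T2Space M] [CovariantDerivative.ContMDiffCovariantDerivative D ∞]

/-- The condition over all representatives `ψ` reduces to the chosen one, because canonical germs
depend only on the germ of `ψ`. Existence and uniqueness follow from this explicit value. -/
theorem isCanonicalHom_iff (hΓ : IsSmoothOriented Γ) (γ : FrameGroupoid Γ → DiffeoGerm) :
    IsCanonicalHom D γ ↔ ∀ g (c : AdaptedCharts D g.rep g.range.1),
      γ g = (DiffeoGerm.mk c.rep)⁻¹ := by
  constructor
  · intro h g c
    obtain ⟨θ, cα, cβ, hθ, hrest⟩ := h g.rep g.rep_mem g.range g.mem_rep_source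
    rw [g.mk'_rep] at hθ
    rw [hθ]
    exact (c.isCanonicalGerm_iff θ).mp ⟨cα, cβ, hrest⟩
  · intro h ψ hψ β hβ
    set g : FrameGroupoid Γ := FrameGroupoid.mk' ψ hψ β hβ with hg
    obtain ⟨c⟩ := nonempty_adaptedCharts D (hΓ.isLocalDiffeo g.rep_mem) g.range.2 g.mem_rep_source
    have h1 : IsCanonicalGerm D g.rep β.1 c.rep.inv := (c.isCanonicalGerm_iff _).mpr rfl
    have h2 : (g.rep : M → M) =ᶠ[𝓝 β.1.1] ψ := (Germ.coe_eq.mp g.germ_rep).symm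
    obtain ⟨cα, cβ, hrest⟩ := h1.congr g.mem_rep_source hβ h2
    exact ⟨c.rep.inv, cα, cβ, h g c, hrest⟩

variable (D) in
theorem existsUnique_canonicalHom (hΓ : IsSmoothOriented Γ) :
    ∃! γ : FrameGroupoid Γ → DiffeoGerm, IsCanonicalHom D γ := by
  have hne : ∀ g : FrameGroupoid Γ, Nonempty (AdaptedCharts D g.rep g.range.1) := fun g =>
    nonempty_adaptedCharts D (hΓ.isLocalDiffeo g.rep_mem) g.range.2 g.mem_rep_source
  refine ⟨fun g => (DiffeoGerm.mk (hne g).some.rep)⁻¹, ?_, ?_⟩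
  · refine (isCanonicalHom_iff hΓ _).mpr fun g c => ?_
    exact (c.isCanonicalGerm_iff _).mp (((hne g).some.isCanonicalGerm_iff
      (hne g).some.rep.inv).mpr rfl)
  · intro γ hγ
    funext g
    exact (isCanonicalHom_iff hΓ γ).mp hγ g _

theorem IsCanonicalHom.map_mul (hΓ : IsSmoothOriented Γ) {γ : FrameGroupoid Γ → DiffeoGerm}
    (hγ : IsCanonicalHom D γ) {ψ₁ : OpenPartialHomeomorph M M} (hψ₁ : ψ₁ ∈ Γ) {β₁ : PosFrame M}
    (hβ₁ : β₁.1.1 ∈ ψ₁.source) {ψ₂ : OpenPartialHomeomorph M M} (hψ₂ : ψ₂ ∈ Γ) {β₂ : PosFrame M}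
    (hβ₂ : β₂.1.1 ∈ ψ₂.source) (h : β₁.1.1 ∈ (ψ₁.trans ψ₂).source)
    (hβ : tangentMap 𝓘(ℝ, ℝ) 𝓘(ℝ, ℝ) ψ₁ β₁.1 = β₂.1) :
    γ (FrameGroupoid.mk' (ψ₁.trans ψ₂) (Γ.trans hψ₁ hψ₂) β₁ h) =
      γ (FrameGroupoid.mk' ψ₁ hψ₁ β₁ hβ₁) * γ (FrameGroupoid.mk' ψ₂ hψ₂ β₂ hβ₂) := by
  obtain ⟨θ₁, cα₁, cβ₁, e₁, h₁⟩ := hγ ψ₁ hψ₁ β₁ hβ₁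
  obtain ⟨θ₂, cα₂, cβ₂, e₂, h₂⟩ := hγ ψ₂ hψ₂ β₂ hβ₂
  obtain ⟨θ, cα, cβ, e, h₃⟩ := hγ (ψ₁.trans ψ₂) (Γ.trans hψ₁ hψ₂) β₁ h
  have hd₁ := hΓ.isLocalDiffeo hψ₁
  have hd₂ := hΓ.isLocalDiffeo hψ₂
  obtain ⟨c⟩ := nonempty_adaptedCharts D (hd₁.trans hd₂) β₁.2 h
  have hm : IsCanonicalGerm D (ψ₁.trans ψ₂) β₁.1 (θ₁.mul θ₂) :=
    IsCanonicalGerm.mul hd₁ hd₂ h ⟨cα₁, cβ₁, h₁⟩ (hβ ▸ ⟨cα₂, cβ₂, h₂⟩)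
  rw [e, e₁, e₂, (c.isCanonicalGerm_iff θ).mp ⟨cα, cβ, h₃⟩]
  exact ((c.isCanonicalGerm_iff _).mp hm).symm

/-- Both factors are the symbol at the range of `g`; the inverse appears because `γ g` is the
inverse of the germ of `c.rep`. -/
theorem IsCanonicalHom.opDelta_value (hΓ : IsSmoothOriented Γ) {γ : FrameGroupoid Γ → DiffeoGerm}
    (hγ : IsCanonicalHom D γ) {a : GroupoidFun Γ} (ha : a ∈ crossedProduct Γ) (n : ℕ)
    (g : FrameGroupoid Γ) :
    (opDelta D n a g).value = ((DiffeoGerm.coord (n + 1) (γ g)⁻¹ : ℝ) : ℂ) * (a g).value := by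
  obtain ⟨c⟩ := nonempty_adaptedCharts D (hΓ.isLocalDiffeo g.rep_mem) g.range.2 g.mem_rep_source
  obtain ⟨F, hF, hFa⟩ := exists_germ_of_mem_crossedProduct c.affine.diffeo c.mem_chart ha
  rw [opDelta_apply c n a F hF hFa, hFa, (isCanonicalHom_iff hΓ γ).mp hγ g c, inv_inv, c.coord_rep]
  rfl

end

end Groupoid

end CrossedProduct

end

theorem theorem8 {M : Type*} [TopologicalSpace M] [T2Space M] [ChartedSpace ℝ M]
    [IsManifold 𝓘(ℝ, ℝ) ∞ M] (hM : CrossedProduct.IsOrientedAtlas M)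
    (D : CrossedProduct.Connection M) [CovariantDerivative.ContMDiffCovariantDerivative D ∞]
    (Γ : StructureGroupoid M) (hΓ : CrossedProduct.IsSmoothOriented Γ) :
    -- the map `γ` is well defined by its formula
    (∃! γ : CrossedProduct.FrameGroupoid Γ → CrossedProduct.DiffeoGerm,
      CrossedProduct.IsCanonicalHom D γ) ∧
    (∀ γ : CrossedProduct.FrameGroupoid Γ → CrossedProduct.DiffeoGerm,
      CrossedProduct.IsCanonicalHom D γ →
      -- it is a homomorphism of groupoids
      (∀ (ψ₁ : OpenPartialHomeomorph M M) (hψ₁ : ψ₁ ∈ Γ) (β₁ : CrossedProduct.PosFrame M)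
        (hβ₁ : β₁.1.1 ∈ ψ₁.source) (ψ₂ : OpenPartialHomeomorph M M) (hψ₂ : ψ₂ ∈ Γ)
        (β₂ : CrossedProduct.PosFrame M) (hβ₂ : β₂.1.1 ∈ ψ₂.source)
        (h : β₁.1.1 ∈ (ψ₁.trans ψ₂).source),
        tangentMap 𝓘(ℝ, ℝ) 𝓘(ℝ, ℝ) ψ₁ β₁.1 = β₂.1 →
        γ (CrossedProduct.FrameGroupoid.mk' (ψ₁.trans ψ₂) (Γ.trans hψ₁ hψ₂) β₁ h) =
          γ (CrossedProduct.FrameGroupoid.mk' ψ₁ hψ₁ β₁ hβ₁) *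
            γ (CrossedProduct.FrameGroupoid.mk' ψ₂ hψ₂ β₂ hβ₂)) ∧
      -- the formula for the action of `δₙ₊₁`
      (∀ a ∈ CrossedProduct.crossedProduct Γ, ∀ (n : ℕ) (g : CrossedProduct.FrameGroupoid Γ),
        (CrossedProduct.opDelta D n a g).value =
          ((CrossedProduct.DiffeoGerm.coord (n + 1) (γ g)⁻¹ : ℝ) : ℂ) * (a g).value)) ∧
    -- the group-like element identified with a germ `φ`, and its pairing with `δₙ₊₁`
    (∃ R : CrossedProduct.DualAlg →ₗ[ℝ] (PowerSeries ℝ →ₗ[ℝ] PowerSeries ℝ),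
      CrossedProduct.IsFunctionAction R ∧
      ∀ φ : CrossedProduct.DiffeoGerm, (∃! A, CrossedProduct.Corresponds R A φ) ∧
        ∀ A, CrossedProduct.Corresponds R A φ → ∀ n : ℕ,
          A (CrossedProduct.hopfDelta n) = CrossedProduct.DiffeoGerm.coord (n + 1) φ⁻¹) := by
  exact ⟨CrossedProduct.existsUnique_canonicalHom D hΓ,
    fun γ hγ => ⟨fun ψ₁ hψ₁ β₁ hβ₁ ψ₂ hψ₂ β₂ hβ₂ h hβ => hγ.map_mul hΓ hψ₁ hβ₁ hψ₂ hβ₂ h hβ,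
      fun a ha n g => hγ.opDelta_value hΓ ha n g⟩,
    CrossedProduct.exists_functionAction⟩
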